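/- Write $\mathcal{P}_d=\{\mathcal N(\mu,\Sigma):\mu\in\mathbb R^d,\ \Sigma\in\mathbb R^{d\times d}\text{ positive definite}\}$. For $\rho\in(0,1)$ let $\mathfrak A_{n,d,\rho}$ be the set of (possibly randomized) algorithms $\mathcal A:(\mathbb R^d)^n\to\mathbb R^d$ of the form $\mathcal A(x_1,\dots,x_n)=\bar{\mathcal A}\big(\frac1n\sum_i x_i\big)$, for a randomized function (Markov kernel) $\bar{\mathcal A}:\mathbb R^d\to\mathbb R^d$, such that for every $\mathcal D\in\mathcal P_d$ with covariance matrix $\Sigma$, if $X_1,\dots,X_n\sim\mathcal D$ are i.i.d., $\bar X=\frac1n\sum_i X_i$ and $\hat\mu\sim\mathcal A(X_1,\dots,X_n)$, then $$\Pr\big((\hat\mu-\bar X)^\top\Sigma^{-1}(\hat\mu-\bar X)\le 2\rho^2 d\big)\ge 0.99 .$$ Let $\mathcal A_{n,\rho}$ be the noisy empirical mean, which on i.i.d. data $X_1,\dots,X_n$ from $\mathcal D\in\mathcal P_d$ with covariance $\Sigma$ outputs $\frac1n\sum_i X_i+\rho Z$, where $Z\sim\mathcal N(0,\Sigma)$ is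 independent of the data. For a family $\mathcal P$ of distributions on $\mathbb R^d$ and a class $\mathfrak A$ of mean estimators, a (measurable) function $\psi:(\mathbb R^d)^m\times\mathbb R^d\times\mathbb R^d\to\{\mathrm{IN},\mathrm{OUT}\}$ is a $(\mathcal P,\mathfrak A,n,m)$-sample-based MIA if, for every $\mathcal A\in\mathfrak A$ and $\mathcal D\in\mathcal P$, when $(X_0,\dots,X_n,Y_1,\dots,Y_m)\sim\mathcal D^{\otimes(n+m+1)}$, $\mathbf Y=(Y_1,\dots,Y_m)$ and $\hat\mu=\mathcal A(X_1,\dots,X_n)$, one has $$\Pr(\psi(\mathbf Y,\hat\mu,X_0)=\mathrm{OUT})\ge 0.51,\qquad \Pr(\psi(\mathbf Y,\hat\mu,X_1)=\mathrm{IN})\ge 0.51 .$$ **Theorem.** There are universal constants $c>1$, $C>0$, $\kappa>0$ such that for all integers $d,m\ge 0$, $n\ge1$ and all $0<\rho<1$ with $$m\ge c\,d,\qquad d\ge c\,(n+n^2\rho^2),$$ there is a $(\mathcal P_d,\ \mathfrak A_{n,d,\rho}\cup\{\mathcal A_{n,\rho}\},\ n,\ m)$-sample-based MIA. More precisely, put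 $m_1=\lceil Cd\rceil$ and $m_2=\lceil C\min\{n,1/\rho^2\}\rceil$. Then $m_1+m_2+1\le m$, and such an attack is given by $$\psi(\mathbf Y,\hat\mu,x)=\mathrm{IN}\iff \big\langle H^{1/2}(\hat\mu-\bar\mu_0),\,H^{1/2}(x-Y_{m_1+m_2+1})\big\rangle=(\hat\mu-\bar\mu_0)^\top H\,(x-Y_{m_1+m_2+1})\ \ge\ \kappa\,\frac dn ,$$ where $\bar\mu_0=\frac1{m_2}\sum_{i=m_1+1}^{m_1+m_2}Y_i$, and $H$ is the inverse of the empirical covariance matrix $\frac1{m_1}\sum_{i=1}^{m_1}(Y_i-\bar Y)(Y_i-\bar Y)^\top$, $\bar Y=\frac1{m_1}\sum_{i=1}^{m_1}Y_i$ (with $H=0$ on the null event that this matrix is singular). -/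

import Mathlib

open MeasureTheory ProbabilityTheory Matrix

noncomputable section

namespace MIA

/-- The data space `ℝ^d`. -/
abbrev E (d : ℕ) : Type := EuclideanSpace ℝ (Fin d)

/-- The covariance matrix of a distribution on `ℝ^d`. -/
def covMatrix {d : ℕ} (D : ProbabilityMeasure (E d)) : Matrix (Fin d) (Fin d) ℝ :=
  Matrix.of fun i j => cov[fun x : E d => x i, fun x : E d => x j; (D : Measure (E d))]

/-- The family `𝒫_d` of all Gaussians `N(μ, Σ)` on `ℝ^d` with `Σ` positive definite. -/
def gaussianFamily (d : ℕ) : Set (ProbabilityMeasure (E d)) :=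
  {D | ∃ (μ : E d) (S : Matrix (Fin d) (Fin d) ℝ),
    S.PosDef ∧ (D : Measure (E d)) = multivariateGaussian μ S}

/-- The empirical mean `(1/n) ∑ xᵢ` of a dataset. -/
def empMean {d n : ℕ} (x : Fin n → E d) : E d := (n : ℝ)⁻¹ • ∑ i, x i

theorem measurable_empMean {d n : ℕ} : Measurable (empMean : (Fin n → E d) → E d) := by
  unfold empMean
  fun_prop

/-- A (randomized) mean estimator on datasets of size `n`: a Markov kernel from datasets to
estimates. The kernel is indexed by the data distribution, so that estimators whose noise is
calibrated to the population (such as `noisyEmpMean`) are covered; an ordinary algorithm, which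
sees only the dataset, is one whose kernel is the same for all distributions. -/
structure MeanEstimator (d n : ℕ) where
  kernel : ProbabilityMeasure (E d) → Kernel (Fin n → E d) (E d)
  markov : ∀ D, IsMarkovKernel (kernel D)

/-- The noisy empirical mean `(1/n) ∑ Xᵢ + ρ Z` with `Z ∼ N(0, Σ)` independent of the data, where
`Σ` is the covariance matrix of the data distribution. -/
def noisyEmpMean (d n : ℕ) (ρ : ℝ) : MeanEstimator d n where
  kernel D := (Kernel.id ×ₖ Kernel.const (Fin n → E d) (multivariateGaussian 0 (covMatrix D))).map
    fun p => empMean p.1 + ρ • p.2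
  markov _ := Kernel.IsMarkovKernel.map _
    ((measurable_empMean.comp measurable_fst).add (measurable_snd.const_smul ρ))

/-- The class `𝔄_{n,d,ρ}`. Its members are algorithms `𝒜(S) = 𝒜bar(empMean S)` for one randomized
function `𝒜bar : ℝ^d → ℝ^d` (the same for all data distributions), such that for every Gaussian with
positive definite covariance `Σ`, with probability at least `0.99` over the dataset `S` and the
output `μ̂`, `(μ̂ - empMean S)ᵀ Σ⁻¹ (μ̂ - empMean S) ≤ 2 ρ² d`. -/
def symmetricClass (n d : ℕ) (ρ : ℝ) : Set (MeanEstimator d n) :=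
  {A | ∃ Abar : Kernel (E d) (E d), IsMarkovKernel Abar ∧
    (∀ D, A.kernel D = Abar.comap empMean measurable_empMean) ∧
    ∀ D ∈ gaussianFamily d,
      0.99 ≤ ((Measure.pi fun _ : Fin n => (D : Measure (E d))) ⊗ₘ A.kernel D).real
        {p | (p.2 - empMean p.1).ofLp ⬝ᵥ (covMatrix D)⁻¹ *ᵥ (p.2 - empMean p.1).ofLp
          ≤ 2 * ρ ^ 2 * d}}

/-- The two possible answers of an attack. -/
inductive Verdict
  | IN
  | OUT

instance : MeasurableSpace Verdict := ⊤

/-- The joint law of `(X₀, ((X₁, …, Xₙ), μ̂), (Y₁, …, Yₘ))`, where `X₀, Xᵢ, Yⱼ` are i.i.d. from `D`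
and `μ̂` is the output of the estimator on `(X₁, …, Xₙ)`. -/
def gameLaw {d n : ℕ} (m : ℕ) (A : MeanEstimator d n) (D : ProbabilityMeasure (E d)) :
    Measure (E d × ((Fin n → E d) × E d) × (Fin m → E d)) :=
  (D : Measure (E d)).prod
    (((Measure.pi fun _ : Fin n => (D : Measure (E d))) ⊗ₘ A.kernel D).prod
      (Measure.pi fun _ : Fin m => (D : Measure (E d))))

/-- `ψ` is a `(𝒫, 𝔄, n, m)`-sample-based membership inference attack: it is a measurable test, and
for every estimator in `𝔄` and every distribution in `𝒫` it answers OUT on the fresh point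
`X₀` and IN on the first training point, each with probability at least `0.51`. -/
def IsSampleBasedMIA {d n m : ℕ} [NeZero n] (P : Set (ProbabilityMeasure (E d)))
    (𝔄 : Set (MeanEstimator d n)) (ψ : (Fin m → E d) → E d → E d → Verdict) : Prop :=
  Measurable (fun p : (Fin m → E d) × E d × E d => ψ p.1 p.2.1 p.2.2) ∧
  ∀ A ∈ 𝔄, ∀ D ∈ P,
    0.51 ≤ (gameLaw m A D).real {ω | ψ ω.2.2 ω.2.1.2 ω.1 = Verdict.OUT} ∧
    0.51 ≤ (gameLaw m A D).real {ω | ψ ω.2.2 ω.2.1.2 (ω.2.1.1 0) = Verdict.IN}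

/-- The `k`-th auxiliary sample, counted from `0` (and `0` beyond the end of the list). -/
def sample {d m : ℕ} (Y : Fin m → E d) (k : ℕ) : E d :=
  if h : k < m then Y ⟨k, h⟩ else 0

/-- The mean of the `k` auxiliary samples number `s, …, s + k - 1`. -/
def blockMean {d m : ℕ} (Y : Fin m → E d) (s k : ℕ) : E d :=
  (k : ℝ)⁻¹ • ∑ i ∈ Finset.range k, sample Y (s + i)

/-- The empirical covariance matrix of the first `k` auxiliary samples. -/
def empCov {d m : ℕ} (Y : Fin m → E d) (k : ℕ) : Matrix (Fin d) (Fin d) ℝ :=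
  (k : ℝ)⁻¹ • ∑ i ∈ Finset.range k,
    Matrix.vecMulVec (sample Y i - blockMean Y 0 k).ofLp (sample Y i - blockMean Y 0 k).ofLp

open Classical in
/-- The whitened inner-product test. With `H` the inverse of the empirical covariance of the first
`m₁` auxiliary samples, `μ̄₀` the mean of the next `m₂` and `Y₀` the one after these, it answers IN
iff `⟨H^{1/2} (μ̂ - μ̄₀), H^{1/2} (x - Y₀)⟩ = (μ̂ - μ̄₀)ᵀ H (x - Y₀)` is at least `t`. -/
def whitenedAttack {d m : ℕ} (m₁ m₂ : ℕ) (t : ℝ) (Y : Fin m → E d) (μhat x : E d) : Verdict :=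
  if t ≤ (μhat - blockMean Y m₁ m₂).ofLp ⬝ᵥ
      (empCov Y m₁)⁻¹ *ᵥ (x - sample Y (m₁ + m₂)).ofLp
  then Verdict.IN else Verdict.OUT

end MIA

end

/-!
The attack statistic is invariant under affine changes of coordinates (`whitenedAttack_affineMap`),
so the data may be taken to be standard Gaussian vectors of `ℝ^d`. Let the estimate be
`μhat = X̄ + σ Z` with `0 ≤ σ ≤ ρ`. The statistic then is `wᵀ H v`, where `w = μhat - μ̄₀` and
`v = x - Y₀` are combinations of standard Gaussian vectors independent of the inverse
empirical covariance `H`, and `w` has coefficient vector of squared length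
`1/n + σ² + 1/m₂`, at most `2d / (c n²)` in the regime of the theorem. Two facts about `H` are
needed, for standard Gaussian vectors `a`, `b` and `H` all independent: `aᵀ H b = O(√d)` and
`aᵀ H a ≥ const · d`. On a fresh point `wᵀ H v` is a cross term, hence `O(d / (n √c))`. On a
training point it contains `X₁ᵀ H X₁ / n`, of order `d / n`, and all other terms are cross terms.

No spectral bound on `H` is used. Let `A = ∑ Yᵢ Yᵢᵀ` be the scatter matrix of `N` standard Gaussian
vectors. The numbers `Pᵢⱼ = Yᵢᵀ A⁻¹ Yⱼ` are the entries of a projection of rank at most `d`, so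
`∑ᵢ Pᵢᵢ ≤ d` and `∑ᵢⱼ Pᵢⱼ² ≤ d`, and by exchangeability a single `Pᵢᵢ` is `O(d / N)` and a single
`Pᵢⱼ` is `O(√d / N)` with large probability. Removing two vectors from `A` makes the rest
independent of them, and at most doubles the off-diagonal entry
(`abs_invForm_le_of_downdate`); this is the cross bound `measureReal_cross_le`. The lower bound
`exists_measureReal_diag_le` is the Cauchy–Schwarz inequality `‖a‖⁴ ≤ (aᵀ B a) (aᵀ B⁻¹ a)` with a
first moment bound for `aᵀ B a`. The centering in the empirical covariance is removed by a rotation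
of the sample (`exists_orthogonal_sampleCov`).

For the noisy empirical mean `σ = ρ`. For the algorithms that see only the empirical mean, the
accuracy requirement is imposed for every Gaussian, in particular for arbitrarily narrow ones. As
`N(μ, Σ)` is a mixture of translates of `N(0, ε Σ)` for each `ε < 1`, such an algorithm returns the
empirical mean exactly with probability at least `0.99` (`le_measureReal_eq_empMean`), and the case
`σ = 0` applies up to an error of `0.01`.
-/

namespace MIA

/-! ### Independent standard Gaussian vectors and scatter matrices -/

/-- The law of a family of independent standard Gaussian vectors of `ℝ^d`, indexed by `κ`. -/
noncomputable def stdFamily (κ : Type*) [Fintype κ] (d : ℕ) : Measure (κ → E d) :=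
  Measure.pi fun _ : κ => stdGaussian (E d)

instance {κ : Type*} [Fintype κ] {d : ℕ} : IsProbabilityMeasure (stdFamily κ d) := by
  unfold stdFamily; infer_instance

section

variable {ι κ : Type*} [Fintype ι] [Fintype κ] {d : ℕ}

/-- Rotation invariance: combinations of independent standard Gaussian vectors with orthonormal
coefficient vectors are again independent standard Gaussian vectors. -/
theorem measurePreserving_comb [DecidableEq κ] (a : κ → ι → ℝ)
    (ha : ∀ k l, ∑ i, a k i * a l i = if k = l then 1 else 0) :
    MeasurePreserving (fun (g : ι → E d) k => ∑ i, a k i • g i)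
      (stdFamily ι d) (stdFamily κ d) where
  measurable := by fun_prop
  map_eq := by
    have hm : Measurable (fun (g : ι → E d) k => ∑ i, a k i • g i) := by fun_prop
    have : IsProbabilityMeasure ((stdFamily ι d).map fun (g : ι → E d) k => ∑ i, a k i • g i) :=
      Measure.isProbabilityMeasure_map hm.aemeasurable
    refine charFun_eq_pi_iff.1 fun t => ?_
    have hs := charFun_pi (μ := fun _ : ι => stdGaussian (E d))
      (WithLp.toLp 2 fun i => ∑ k, a k i • t k)
    rw [charFun_apply, integral_map (by fun_prop) (by fun_prop)] at hs ⊢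
    rw [integral_map hm.aemeasurable (by fun_prop)]
    have hin : ∀ g : ι → E d, inner ℝ (WithLp.toLp 2 fun k => ∑ i, a k i • g i) t
        = inner ℝ (WithLp.toLp 2 g) (WithLp.toLp 2 fun i => ∑ k, a k i • t k) := by
      intro g
      rw [PiLp.inner_apply, PiLp.inner_apply]
      simp_rw [sum_inner, inner_sum, real_inner_smul_left, real_inner_smul_right]
      exact Finset.sum_comm
    simp_rw [hin]
    refine hs.trans ?_
    simp_rw [charFun_stdGaussian, ← Complex.exp_sum]
    congr 1
    have hn : ∑ i, ‖∑ k, a k i • t k‖ ^ 2 = ∑ k, ‖t k‖ ^ 2 := by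
      simp_rw [← real_inner_self_eq_norm_sq, sum_inner, inner_sum, real_inner_smul_left,
        real_inner_smul_right]
      rw [Finset.sum_comm]
      refine Finset.sum_congr rfl fun k _ => ?_
      rw [Finset.sum_comm]
      have : ∀ l, ∑ i, a k i * (a l i * inner ℝ (t k) (t l))
          = (if k = l then 1 else 0) * inner ℝ (t k) (t l) := by
        intro l
        rw [← ha k l, Finset.sum_mul]
        exact Finset.sum_congr rfl fun i _ => by ring
      simp [this]
    simp only [neg_div, Finset.sum_neg_distrib, ← Finset.sum_div]
    exact_mod_cast congrArg (fun x : ℝ => -(((x / 2 : ℝ)) : ℂ)) hn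

theorem measurePreserving_reindex [DecidableEq κ] [DecidableEq ι] (e : κ → ι)
    (he : Function.Injective e) :
    MeasurePreserving (fun (g : ι → E d) k => g (e k)) (stdFamily ι d) (stdFamily κ d) := by
  have := measurePreserving_comb (d := d) (fun k i => if i = e k then (1 : ℝ) else 0)
    (fun k l => by simp [he.eq_iff, eq_comm])
  simpa [ite_smul] using this

end

section

variable {κ : Type*} {d : ℕ}

/-- The scatter matrix `∑ Yᵢ Yᵢᵀ` of the vectors with index in `s`. -/
def scatter (s : Finset κ) (Y : κ → E d) : Matrix (Fin d) (Fin d) ℝ :=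
  ∑ i ∈ s, vecMulVec (Y i).ofLp (Y i).ofLp

/-- The bilinear form `uᵀ B⁻¹ v`; it is `0` when `B` is singular. -/
noncomputable def invForm (B : Matrix (Fin d) (Fin d) ℝ) (u v : E d) : ℝ :=
  u.ofLp ⬝ᵥ B⁻¹ *ᵥ v.ofLp

theorem continuous_scatter (s : Finset κ) :
    Continuous (scatter s : (κ → E d) → Matrix (Fin d) (Fin d) ℝ) := by
  unfold scatter
  refine continuous_finsetSum _ fun i _ => ?_
  refine Continuous.matrix_vecMulVec ?_ ?_ <;> fun_prop

theorem measurable_invForm {X : Type*} [TopologicalSpace X] [MeasurableSpace X]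
    [OpensMeasurableSpace X] {B : X → Matrix (Fin d) (Fin d) ℝ} {u v : X → E d}
    (hB : Continuous B) (hu : Continuous u) (hv : Continuous v) :
    Measurable fun x => invForm (B x) (u x) (v x) := by
  have h : (fun x => invForm (B x) (u x) (v x)) = fun x => ((B x).det)⁻¹ *
      ((u x).ofLp ⬝ᵥ (B x).adjugate *ᵥ (v x).ofLp) := by
    funext x
    rw [invForm, Matrix.inv_def, Ring.inverse_eq_inv', smul_mulVec, dotProduct_smul, smul_eq_mul]
  rw [h]
  have h1 : Continuous fun x => (B x).det := hB.matrix_det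
  have hu' : Continuous fun x => (u x).ofLp := by fun_prop
  have hv' : Continuous fun x => (v x).ofLp := by fun_prop
  have h2 : Continuous fun x => (u x).ofLp ⬝ᵥ (B x).adjugate *ᵥ (v x).ofLp :=
    hu'.dotProduct (hB.matrix_adjugate.matrix_mulVec hv')
  exact h1.measurable.inv.mul h2.measurable

theorem dotProduct_scatter_mulVec (s : Finset κ) (Y : κ → E d) (x y : Fin d → ℝ) :
    x ⬝ᵥ scatter s Y *ᵥ y = ∑ i ∈ s, (x ⬝ᵥ (Y i).ofLp) * ((Y i).ofLp ⬝ᵥ y) := by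
  simp [scatter, sum_mulVec, dotProduct_sum, vecMulVec_mulVec, mul_comm]

theorem scatter_transpose (s : Finset κ) (Y : κ → E d) : (scatter s Y)ᵀ = scatter s Y := by
  simp [scatter, transpose_sum, transpose_vecMulVec]

theorem invForm_comm {B : Matrix (Fin d) (Fin d) ℝ} (hB : Bᵀ = B) (u v : E d) :
    invForm B u v = invForm B v u := by
  rw [invForm, invForm, dotProduct_mulVec, ← mulVec_transpose, transpose_nonsing_inv, hB,
    dotProduct_comm]

/-- The matrix with entries `Yᵢᵀ A⁻¹ Yⱼ` is idempotent; if `A` is singular it is `0`. -/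
theorem sum_sq_invForm (t : Finset κ) (Y : κ → E d) (u : E d) :
    ∑ j ∈ t, invForm (scatter t Y) u (Y j) ^ 2 = invForm (scatter t Y) u u := by
  set A := scatter t Y with hA
  have hs : Aᵀ = A := scatter_transpose t Y
  have h1 : ∑ j ∈ t, invForm A u (Y j) ^ 2
      = (A⁻¹ *ᵥ u.ofLp) ⬝ᵥ A *ᵥ (A⁻¹ *ᵥ u.ofLp) := by
    rw [hA, dotProduct_scatter_mulVec, ← hA]
    refine Finset.sum_congr rfl fun j _ => ?_
    rw [sq]
    congr 1
    · rw [invForm_comm hs, invForm, dotProduct_comm]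
    · rw [invForm_comm hs, invForm]
  rw [h1]
  by_cases h : IsUnit A.det
  · have h2 : A *ᵥ (A⁻¹ *ᵥ u.ofLp) = u.ofLp := by
      rw [mulVec_mulVec, mul_nonsing_inv _ h, one_mulVec]
    rw [h2, dotProduct_comm, invForm]
  · simp [invForm, nonsing_inv_apply_not_isUnit _ h]

/-- The trace of the projection with entries `Yᵢᵀ A⁻¹ Yⱼ` is at most the dimension. -/
theorem sum_invForm_le (t : Finset κ) (Y : κ → E d) :
    ∑ i ∈ t, invForm (scatter t Y) (Y i) (Y i) ≤ d := by
  set A := scatter t Y with hA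
  have h1 : ∑ i ∈ t, invForm A (Y i) (Y i) = (A⁻¹ * A).trace := by
    have h2 : A⁻¹ * A = ∑ i ∈ t, A⁻¹ * vecMulVec (Y i).ofLp (Y i).ofLp := by
      rw [← Finset.mul_sum, hA, scatter]
    rw [h2, trace_sum]
    refine Finset.sum_congr rfl fun i _ => ?_
    rw [mul_vecMulVec, trace_vecMulVec, invForm, dotProduct_comm]
  rw [h1]
  by_cases h : IsUnit A.det
  · simp [nonsing_inv_mul _ h]
  · simp [nonsing_inv_apply_not_isUnit _ h]

end

/-! ### Leverages and removal of vectors from a scatter matrix -/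

section

variable {κ : Type*} {d : ℕ}

theorem scatter_insert [DecidableEq κ] {s : Finset κ} {p : κ} (hp : p ∉ s) (Y : κ → E d) :
    scatter (insert p s) Y = vecMulVec (Y p).ofLp (Y p).ofLp + scatter s Y := by
  rw [scatter, Finset.sum_insert hp, scatter]

theorem invForm_scatter_nonneg (t : Finset κ) (Y : κ → E d) (u : E d) :
    0 ≤ invForm (scatter t Y) u u := by
  rw [← sum_sq_invForm]
  exact Finset.sum_nonneg fun _ _ => sq_nonneg _

/-- A scatter matrix is singular only if the vectors fail to span. -/
theorem exists_orthogonal_of_det_scatter_eq_zero {s : Finset κ} {Y : κ → E d}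
    (h : (scatter s Y).det = 0) : ∃ x : Fin d → ℝ, x ≠ 0 ∧ ∀ i ∈ s, (Y i).ofLp ⬝ᵥ x = 0 := by
  obtain ⟨x, hx, hx'⟩ := exists_mulVec_eq_zero_iff.2 h
  refine ⟨x, hx, ?_⟩
  have h1 := dotProduct_scatter_mulVec s Y x x
  rw [hx', dotProduct_zero] at h1
  have h2 : ∑ i ∈ s, ((Y i).ofLp ⬝ᵥ x) ^ 2 = 0 := by
    rw [h1]
    exact Finset.sum_congr rfl fun i _ => by rw [dotProduct_comm x, sq]
  intro i hi
  exact pow_eq_zero_iff two_ne_zero |>.1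
    ((Finset.sum_eq_zero_iff_of_nonneg fun i _ => sq_nonneg _).1 h2 i hi)

theorem det_scatter_ne_zero_of_subset {s t : Finset κ} (hst : s ⊆ t) {Y : κ → E d}
    (h : (scatter s Y).det ≠ 0) : (scatter t Y).det ≠ 0 := by
  intro h0
  obtain ⟨x, hx, hx'⟩ := exists_orthogonal_of_det_scatter_eq_zero h0
  refine h (exists_mulVec_eq_zero_iff.1 ⟨x, hx, ?_⟩)
  simp only [scatter, sum_mulVec, vecMulVec_mulVec]
  refine Finset.sum_eq_zero fun i hi => ?_
  rw [hx' i (hst hi)]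
  simp

/-- Removing two vectors `a`, `b` from a scatter matrix `A` at most doubles `|aᵀ A⁻¹ b|` as long as
the leverages `aᵀ A⁻¹ a`, `bᵀ A⁻¹ b` and `aᵀ A⁻¹ b` are small. -/
theorem abs_invForm_le_of_downdate [DecidableEq κ] {s : Finset κ} {p q : κ} (hp : p ∉ s)
    (hq : q ∉ s) (hpq : p ≠ q) {Y : κ → E d} (hB : (scatter s Y).det ≠ 0)
    (hpp : invForm (scatter (insert p (insert q s)) Y) (Y p) (Y p) ≤ 1 / 4)
    (hqq : invForm (scatter (insert p (insert q s)) Y) (Y q) (Y q) ≤ 1 / 4)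
    (hpq' : invForm (scatter (insert p (insert q s)) Y) (Y p) (Y q) ^ 2 ≤ 1 / 16) :
    |invForm (scatter s Y) (Y p) (Y q)|
      ≤ 2 * |invForm (scatter (insert p (insert q s)) Y) (Y p) (Y q)| := by
  set t := insert p (insert q s)
  have hst : s ⊆ t := (Finset.subset_insert q s).trans (Finset.subset_insert _ _)
  set A := scatter t Y with hA
  set B := scatter s Y with hBd
  have hAdet : A.det ≠ 0 := det_scatter_ne_zero_of_subset hst hB
  have hAt : Aᵀ = A := scatter_transpose t Y
  set a := (Y p).ofLp
  set b := (Y q).ofLp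
  have hAB : A = vecMulVec a a + (vecMulVec b b + B) := by
    rw [hA, scatter_insert (by simp [hp, hpq]), scatter_insert hq]
  -- With `x = B⁻¹ b` and `A = B + a aᵀ + b bᵀ`, the equation `A x = (aᵀ x) a + (1 + bᵀ x) b`
  -- expresses `aᵀ x` and `bᵀ x` through the leverages.
  set x := B⁻¹ *ᵥ b with hx
  have hBx : B *ᵥ x = b := by
    rw [hx, mulVec_mulVec, mul_nonsing_inv _ (isUnit_iff_ne_zero.2 hB), one_mulVec]
  have hAx : A *ᵥ x = (a ⬝ᵥ x) • a + (1 + b ⬝ᵥ x) • b := by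
    rw [hAB, add_mulVec, add_mulVec, hBx, vecMulVec_mulVec, vecMulVec_mulVec]
    ext i
    simp
    ring
  have hxA : x = (a ⬝ᵥ x) • A⁻¹ *ᵥ a + (1 + b ⬝ᵥ x) • A⁻¹ *ᵥ b := by
    rw [← mulVec_smul, ← mulVec_smul, ← mulVec_add, ← hAx, mulVec_mulVec,
      nonsing_inv_mul _ (isUnit_iff_ne_zero.2 hAdet), one_mulVec]
  set β := a ⬝ᵥ x with hβ
  set γ := b ⬝ᵥ x with hγ
  set α := invForm A (Y p) (Y p) with hα
  set δ := invForm A (Y q) (Y q) with hδ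
  set ε := invForm A (Y p) (Y q) with hε
  have e1 : β = β * α + (1 + γ) * ε := by
    conv_lhs => rw [hβ, hxA, dotProduct_add, dotProduct_smul, dotProduct_smul]
    rfl
  have hε' : b ⬝ᵥ A⁻¹ *ᵥ a = ε := by
    rw [hε, invForm_comm hAt]; rfl
  have e2 : γ = β * ε + (1 + γ) * δ := by
    conv_lhs => rw [hγ, hxA, dotProduct_add, dotProduct_smul, dotProduct_smul, hε']
    rfl
  have e3 : β * ((1 - α) * (1 - δ) - ε ^ 2) = ε := by
    linear_combination (1 - δ) * e1 + ε * e2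
  have h0 : 1 / 2 ≤ (1 - α) * (1 - δ) - ε ^ 2 := by nlinarith
  have hgoal : |β| ≤ 2 * |ε| := by
    rw [← e3, abs_mul, abs_of_pos (by linarith : (0:ℝ) < (1 - α) * (1 - δ) - ε ^ 2)]
    nlinarith [abs_nonneg β]
  exact hgoal

/-- Cauchy–Schwarz for the inner product of a nonsingular scatter matrix. -/
theorem norm_pow_four_le_of_scatter {s : Finset κ} {Y : κ → E d} (hB : (scatter s Y).det ≠ 0)
    (u : E d) :
    (‖u‖ ^ 2) ^ 2 ≤ (∑ i ∈ s, inner ℝ u (Y i) ^ 2) * invForm (scatter s Y) u u := by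
  set B := scatter s Y with hBd
  set x := B⁻¹ *ᵥ u.ofLp with hx
  have hBx : B *ᵥ x = u.ofLp := by
    rw [hx, mulVec_mulVec, mul_nonsing_inv _ (isUnit_iff_ne_zero.2 hB), one_mulVec]
  have h1 : ‖u‖ ^ 2 = ∑ i ∈ s, (u.ofLp ⬝ᵥ (Y i).ofLp) * ((Y i).ofLp ⬝ᵥ x) := by
    rw [← dotProduct_scatter_mulVec, ← hBd, hBx, EuclideanSpace.real_norm_sq_eq]
    simp [dotProduct, sq]
  have h2 : invForm B u u = ∑ i ∈ s, ((Y i).ofLp ⬝ᵥ x) ^ 2 := by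
    have : invForm B u u = x ⬝ᵥ B *ᵥ x := by rw [hBx, dotProduct_comm]; rfl
    rw [this, hBd, dotProduct_scatter_mulVec]
    exact Finset.sum_congr rfl fun i _ => by rw [dotProduct_comm x, sq]
  have h3 : ∀ i, inner ℝ u (Y i) = u.ofLp ⬝ᵥ (Y i).ofLp := fun i => by
    rw [EuclideanSpace.inner_eq_star_dotProduct, dotProduct_comm]; simp
  rw [h2]
  simp_rw [h3]
  rw [h1]
  exact Finset.sum_mul_sq_le_sq_mul_sq _ _ _

end

section

variable {d : ℕ}

theorem stdGaussian_submodule_eq_zero {V : Submodule ℝ (E d)} (hV : V ≠ ⊤) :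
    stdGaussian (E d) (V : Set (E d)) = 0 := by
  obtain ⟨u, hu, hu0⟩ := Submodule.exists_mem_ne_zero_of_ne_bot
    (fun h => hV ((Submodule.orthogonal_eq_bot_iff).1 h))
  have hsub : (V : Set (E d)) ⊆ innerSL ℝ u ⁻¹' {0} := fun x hx => by
    have := (Submodule.mem_orthogonal' V u).1 hu x hx
    simpa using this
  refine measure_mono_null hsub ?_
  rw [← Measure.map_apply (by fun_prop) (measurableSet_singleton 0),
    IsGaussian.map_eq_gaussianReal]
  have hv : Var[innerSL ℝ u; stdGaussian (E d)] = ‖u‖ ^ 2 := by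
    rw [variance_dual_stdGaussian, innerSL_apply_norm]
  have hne : Var[innerSL ℝ u; stdGaussian (E d)].toNNReal ≠ 0 := by
    rw [hv]
    have : 0 < ‖u‖ := norm_pos_iff.2 hu0
    simp [hu0]
  exact (nullSingletonClass_gaussianReal hne).measure_singleton 0

theorem ae_linearIndependent_stdFamily {j : ℕ} (hj : j ≤ d) :
    ∀ᵐ g ∂stdFamily (Fin j) d, LinearIndependent ℝ g := by
  induction j with
  | zero => exact Filter.Eventually.of_forall fun g => linearIndependent_empty_type
  | succ j ih =>
    have hmp := (measurePreserving_piFinSuccAbove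
      (fun _ : Fin (j + 1) => stdGaussian (E d)) 0)
    have hms : MeasurableSet {p : (Fin j → E d) × E d |
        ¬ LinearIndependent ℝ (Fin.cons p.2 p.1 : Fin (j + 1) → E d)} := by
      refine (IsOpen.measurableSet ?_).compl
      refine (isOpen_setOfPred_linearIndependent (𝕜 := ℝ) (E := E d)
        (ι := Fin (j + 1))).preimage ?_
      refine continuous_pi fun i => ?_
      refine Fin.cases ?_ (fun i => ?_) i <;> simp <;> fun_prop
    have h0 : ((stdFamily (Fin j) d).prod (stdGaussian (E d))) {p : (Fin j → E d) × E d |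
        ¬ LinearIndependent ℝ (Fin.cons p.2 p.1 : Fin (j + 1) → E d)} = 0 := by
      rw [Measure.measure_prod_null hms]
      filter_upwards [ih (by omega)] with g hg
      have hspan : Submodule.span ℝ (Set.range g) ≠ ⊤ := by
        intro htop
        have h1 := finrank_span_eq_card hg
        rw [htop, finrank_top, finrank_euclideanSpace_fin, Fintype.card_fin] at h1
        omega
      refine measure_mono_null (fun x hx => ?_) (stdGaussian_submodule_eq_zero hspan)
      by_contra hx'
      exact hx (linearIndependent_finCons.2 ⟨hg, hx'⟩)
    have hmp2 : MeasurePreserving (fun g : Fin (j + 1) → E d => ((fun i => g i.succ), g 0))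
        (stdFamily (Fin (j + 1)) d) ((stdFamily (Fin j) d).prod (stdGaussian (E d))) :=
      Measure.measurePreserving_swap.comp hmp
    have h1 := hmp2.measure_preimage hms.nullMeasurableSet
    rw [h0] at h1
    refine measure_mono_null (fun g hg => ?_) h1
    intro h
    refine hg ?_
    have : (Fin.cons (g 0) (fun i => g i.succ) : Fin (j + 1) → E d) = g := Fin.cons_self_tail g
    rwa [this] at h

/-- The scatter matrix of at least `d` standard Gaussian vectors is almost surely nonsingular, as any
`d` of them are almost surely linearly independent. -/
theorem ae_det_scatter_ne_zero {κ : Type*} [Fintype κ] [DecidableEq κ] (s : Finset κ)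
    (hs : d ≤ s.card) : ∀ᵐ Y ∂stdFamily κ d, (scatter s Y).det ≠ 0 := by
  obtain ⟨e, he⟩ : ∃ e : Fin d → κ, Function.Injective e ∧ ∀ i, e i ∈ s := by
    obtain ⟨u, hu, hc⟩ := Finset.exists_subset_card_eq hs
    refine ⟨fun i => (u.equivFin.symm (i.cast hc.symm)).1, fun i j hij => ?_, fun i => hu (by simp)⟩
    simpa [Subtype.coe_inj] using hij
  have h1 := (measurePreserving_reindex (d := d) e he.1).quasiMeasurePreserving.ae
    (ae_linearIndependent_stdFamily le_rfl)
  filter_upwards [h1] with Y hY h0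
  obtain ⟨x, hx, hx'⟩ := exists_orthogonal_of_det_scatter_eq_zero h0
  have hspan := hY.span_eq_top_of_card_eq_finrank' (by simp)
  have : ∀ y ∈ Submodule.span ℝ (Set.range fun i => Y (e i)),
      inner ℝ y (WithLp.toLp 2 x) = 0 := by
    intro y hy
    induction hy using Submodule.span_induction with
    | mem y hy =>
      obtain ⟨i, rfl⟩ := hy
      have := hx' (e i) (he.2 i)
      rw [EuclideanSpace.inner_eq_star_dotProduct, dotProduct_comm]
      simpa using this
    | zero => simp
    | add y z _ _ hy hz => rw [inner_add_left, hy, hz, add_zero]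
    | smul c y _ hy => rw [inner_smul_left, hy, mul_zero]
  have h2 := this (WithLp.toLp 2 x) (by rw [hspan]; trivial)
  rw [inner_self_eq_zero] at h2
  exact hx (by simpa using h2)

end

/-! ### Probability bounds for inverse scatter matrices -/

/-- Markov's inequality for an exchangeable family: if the events `{δ ≤ fᵢ}` are equally likely and
the sum of the `fᵢ` is at most `D`, each of them has probability at most `D / (#t δ)`. -/
theorem card_mul_measureReal_le {X I : Type*} [MeasurableSpace X] {μ : Measure X}
    [IsProbabilityMeasure μ] (t : Finset I) {f : I → X → ℝ} {D δ P : ℝ}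
    (hf : ∀ i, Measurable (f i)) (hf0 : ∀ i x, 0 ≤ f i x) (hD : ∀ x, ∑ i ∈ t, f i x ≤ D)
    (hP : ∀ i ∈ t, μ.real {x | δ ≤ f i x} = P) : t.card * (δ * P) ≤ D := by
  have hint : ∀ i ∈ t, Integrable (f i) μ := fun i hi =>
    Integrable.of_bound (hf i).aestronglyMeasurable D (Filter.Eventually.of_forall fun x => by
      rw [Real.norm_of_nonneg (hf0 i x)]
      exact (Finset.single_le_sum (f := fun i => f i x) (fun j _ => hf0 j x) hi).trans (hD x))
  have h1 : ∑ i ∈ t, δ * P ≤ ∑ i ∈ t, ∫ x, f i x ∂μ := Finset.sum_le_sum fun i hi => by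
    rw [← hP i hi]
    exact mul_meas_ge_le_integral_of_nonneg (Filter.Eventually.of_forall (hf0 i)) (hint i hi) δ
  rw [← integral_finsetSum t hint] at h1
  have h2 : ∫ x, ∑ i ∈ t, f i x ∂μ ≤ ∫ _, D ∂μ :=
    integral_mono (integrable_finsetSum t hint) (integrable_const D) hD
  simp only [Finset.sum_const, nsmul_eq_mul, integral_const, probReal_univ, one_smul] at h1 h2
  linarith

section

variable {κ : Type*} [Fintype κ] {d : ℕ}

theorem measurable_invForm_scatter (t : Finset κ) (i j : κ) :
    Measurable fun Y : κ → E d => invForm (scatter t Y) (Y i) (Y j) :=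
  measurable_invForm (continuous_scatter t) (continuous_apply i) (continuous_apply j)

variable [DecidableEq κ]

/-- Exchangeability: swapping two vectors of the scatter matrix does not change the law of an entry
of the projection. -/
theorem measureReal_invForm_swap (t : Finset κ) {a b : κ} (ha : a ∈ t) (hb : b ∈ t) (i j : κ)
    {S : Set ℝ} (hS : MeasurableSet S) :
    (stdFamily κ d).real {Y | invForm (scatter t Y) (Y (Equiv.swap a b i)) (Y (Equiv.swap a b j)) ∈ S}
      = (stdFamily κ d).real {Y | invForm (scatter t Y) (Y i) (Y j) ∈ S} := by
  have hmp := measurePreserving_reindex (d := d) (Equiv.swap a b) (Equiv.injective _)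
  have hms := (measurable_invForm_scatter (d := d) t i j) hS
  rw [show {Y : κ → E d | invForm (scatter t Y) (Y i) (Y j) ∈ S}
    = (fun Y : κ → E d => invForm (scatter t Y) (Y i) (Y j)) ⁻¹' S from rfl,
    ← hmp.measureReal_preimage hms.nullMeasurableSet]
  congr 1
  ext Y
  have hsc : scatter t (fun k => Y (Equiv.swap a b k)) = scatter t Y := by
    unfold scatter
    refine Finset.sum_equiv (Equiv.swap a b) (fun k => ?_) (fun _ _ => rfl)
    by_cases h1 : k = a
    · simp [h1, ha, hb]
    by_cases h2 : k = b
    · simp [h2, ha, hb]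
    rw [Equiv.swap_apply_of_ne_of_ne h1 h2]
  simp only [Set.mem_preimage, Set.mem_ofPred_eq, hsc]

theorem measureReal_leverage_le (t : Finset κ) {p : κ} (hp : p ∈ t) (δ : ℝ) :
    t.card * (δ * (stdFamily κ d).real {Y | δ ≤ invForm (scatter t Y) (Y p) (Y p)}) ≤ d := by
  refine card_mul_measureReal_le (μ := stdFamily κ d) t (f := fun i Y => invForm (scatter t Y) (Y i) (Y i))
    (fun i => measurable_invForm_scatter t i i) (fun i Y => invForm_scatter_nonneg t Y _)
    (sum_invForm_le t) fun i hi => ?_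
  have := measureReal_invForm_swap (d := d) t hp hi p p (measurableSet_Ici (a := δ))
  simpa using this

theorem measureReal_cross_leverage_le (t : Finset κ) {p q : κ} (hp : p ∈ t) (hq : q ∈ t)
    (hpq : p ≠ q) (δ : ℝ) :
    t.offDiag.card *
      (δ * (stdFamily κ d).real {Y | δ ≤ invForm (scatter t Y) (Y p) (Y q) ^ 2}) ≤ d := by
  refine card_mul_measureReal_le (μ := stdFamily κ d) t.offDiag
    (f := fun i Y => invForm (scatter t Y) (Y i.1) (Y i.2) ^ 2)
    (fun i => (measurable_invForm_scatter t _ _).pow_const 2) (fun i Y => sq_nonneg _)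
    (fun Y => ?_) fun i hi => ?_
  · calc ∑ i ∈ t.offDiag, invForm (scatter t Y) (Y i.1) (Y i.2) ^ 2
        ≤ ∑ i ∈ t ×ˢ t, invForm (scatter t Y) (Y i.1) (Y i.2) ^ 2 :=
          Finset.sum_le_sum_of_subset_of_nonneg (fun x hx => by
            rw [Finset.mem_offDiag] at hx; simp [hx.1, hx.2.1]) fun _ _ _ => sq_nonneg _
      _ = ∑ i ∈ t, invForm (scatter t Y) (Y i) (Y i) := by
          rw [Finset.sum_product]
          exact Finset.sum_congr rfl fun i _ => sum_sq_invForm t Y (Y i)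
      _ ≤ d := sum_invForm_le t Y
  · obtain ⟨i, j⟩ := i
    obtain ⟨hi, hj, hij⟩ := Finset.mem_offDiag.1 hi
    have hS : MeasurableSet {x : ℝ | δ ≤ x ^ 2} := measurableSet_le (by fun_prop) (by fun_prop)
    -- Two swaps carry the pair `(p, q)` to `(i, j)`: the first moves `p` to `i`.
    have h1 := measureReal_invForm_swap (d := d) t hp hi p q hS
    set r := Equiv.swap p i q with hr
    have hrt : r ∈ t := by
      rw [hr, Equiv.swap_apply_def]; split_ifs <;> assumption
    have hri : r ≠ i := fun h => hpq
      ((Equiv.swap p i).injective (by rw [← hr, h, Equiv.swap_apply_left]))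
    have h2 := measureReal_invForm_swap (d := d) t hrt hj i r hS
    rw [Equiv.swap_apply_left] at h1
    rw [Equiv.swap_apply_of_ne_of_ne hri.symm hij, Equiv.swap_apply_left] at h2
    exact h2.trans h1

/-- For independent standard Gaussian vectors `a`, `b` and an independent scatter matrix `B` of
`N ≥ 1000 d` such vectors, `aᵀ B⁻¹ b` is at most of order `√d / N`. -/
theorem measureReal_cross_le (hd : 0 < d) {s : Finset κ} (hs : 1000 * d ≤ s.card) {p q : κ}
    (hp : p ∉ s) (hq : q ∉ s) (hpq : p ≠ q) :
    (stdFamily κ d).real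
      {Y | 20 * √d / s.card < |invForm (scatter s Y) (Y p) (Y q)|} ≤ 1 / 50 := by
  set t := insert p (insert q s) with ht
  have hpt : p ∈ t := by simp [ht]
  have hqt : q ∈ t := by simp [ht]
  have htc : t.card = s.card + 2 := by
    rw [ht, Finset.card_insert_of_notMem (by simp [hp, hpq]), Finset.card_insert_of_notMem hq]
  have hd' : (1 : ℝ) ≤ d := by exact_mod_cast hd
  have hsN : 1000 * (d : ℝ) ≤ s.card := by exact_mod_cast hs
  set N : ℝ := (s.card : ℝ) with hN
  have hN0 : 0 < N := by linarith
  have htN : (t.card : ℝ) = N + 2 := by rw [htc]; push_cast; rfl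
  have hoff : N ^ 2 ≤ (t.offDiag.card : ℝ) := by
    rw [Finset.offDiag_card, Nat.cast_sub (Nat.le_mul_self _)]
    push_cast
    rw [htN]
    nlinarith
  set μ := stdFamily κ d
  -- The three events excluded below have total probability at most `2/250 + 1/100`.
  set A1 : Set (κ → E d) := {Y | 1 / 4 ≤ invForm (scatter t Y) (Y p) (Y p)}
  set A2 : Set (κ → E d) := {Y | 1 / 4 ≤ invForm (scatter t Y) (Y q) (Y q)}
  set A3 : Set (κ → E d) := {Y | 100 * d / N ^ 2 ≤ invForm (scatter t Y) (Y p) (Y q) ^ 2}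
  have h1 : μ.real A1 ≤ 1 / 250 := by
    have := measureReal_leverage_le (d := d) t hpt (1 / 4)
    rw [htN] at this
    have h0 : 0 ≤ μ.real A1 := measureReal_nonneg
    change (N + 2) * (1 / 4 * μ.real A1) ≤ d at this
    nlinarith
  have h2 : μ.real A2 ≤ 1 / 250 := by
    have := measureReal_leverage_le (d := d) t hqt (1 / 4)
    rw [htN] at this
    have h0 : 0 ≤ μ.real A2 := measureReal_nonneg
    change (N + 2) * (1 / 4 * μ.real A2) ≤ d at this
    nlinarith
  have h3 : μ.real A3 ≤ 1 / 100 := by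
    have := measureReal_cross_leverage_le (d := d) t hpt hqt hpq (100 * d / N ^ 2)
    change t.offDiag.card * (100 * d / N ^ 2 * μ.real A3) ≤ d at this
    have h0 : 0 ≤ μ.real A3 := measureReal_nonneg
    have h4 : N ^ 2 * (100 * d / N ^ 2 * μ.real A3) ≤ d :=
      (mul_le_mul_of_nonneg_right hoff (by positivity)).trans this
    have h5 : N ^ 2 * (100 * d / N ^ 2 * μ.real A3) = d * (100 * μ.real A3) := by
      field_simp
    rw [h5] at h4
    nlinarith
  have hdet := ae_det_scatter_ne_zero (d := d) s (by omega)
  have hsub : {Y | 20 * √d / N < |invForm (scatter s Y) (Y p) (Y q)|}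
      ≤ᵐ[μ] (A1 ∪ A2 ∪ A3 : Set (κ → E d)) := by
    filter_upwards [hdet] with Y hY hbad
    by_contra hgood
    have hg1 : ¬ 1 / 4 ≤ invForm (scatter t Y) (Y p) (Y p) := fun h => hgood (Or.inl (Or.inl h))
    have hg2 : ¬ 1 / 4 ≤ invForm (scatter t Y) (Y q) (Y q) := fun h => hgood (Or.inl (Or.inr h))
    have hg3 : ¬ 100 * d / N ^ 2 ≤ invForm (scatter t Y) (Y p) (Y q) ^ 2 :=
      fun h => hgood (Or.inr h)
    push Not at hg1 hg2 hg3
    have hsmall : 100 * d / N ^ 2 ≤ 1 / 16 := by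
      rw [div_le_div_iff₀ (by positivity) (by norm_num)]
      nlinarith
    have hdown := abs_invForm_le_of_downdate hp hq hpq hY hg1.le hg2.le (hg3.le.trans hsmall)
    have hb : 20 * √d / N < |invForm (scatter s Y) (Y p) (Y q)| := hbad
    have hsq : |invForm (scatter t Y) (Y p) (Y q)| ≤ 10 * √d / N := by
      refine abs_le_of_sq_le_sq (hg3.le.trans ?_) (by positivity)
      rw [div_pow, mul_pow, Real.sq_sqrt (by positivity)]
      norm_num
    have : 20 * √d / N = 2 * (10 * √d / N) := by ring
    linarith
  calc μ.real {Y | 20 * √d / N < |invForm (scatter s Y) (Y p) (Y q)|}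
      ≤ μ.real (A1 ∪ A2 ∪ A3) :=
        ENNReal.toReal_mono (measure_ne_top _ _) (measure_mono_ae hsub)
    _ ≤ μ.real A1 + μ.real A2 + μ.real A3 :=
        (measureReal_union_le _ _).trans (by gcongr; exact measureReal_union_le _ _)
    _ ≤ 1 / 50 := by linarith

end

section

/-- The squared norm of a standard Gaussian vector concentrates around its mean `d`. -/
theorem exists_measureReal_norm_sq_lt_le : ∃ d₀ : ℝ, 1 ≤ d₀ ∧ ∀ d : ℕ, d₀ ≤ d →
    (stdGaussian (E d)).real {x | ‖x‖ ^ 2 < d / 2} ≤ 1 / 50 := by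
  set V : ℝ := Var[fun x : ℝ => x ^ 2; gaussianReal 0 1] with hV
  have hV0 : 0 ≤ V := variance_nonneg _ _
  refine ⟨200 * V + 1, by linarith, fun d hd => ?_⟩
  have hd0 : (0 : ℝ) < d := by linarith
  have hmem : MemLp (fun x : ℝ => x ^ 2) 2 (gaussianReal 0 1) := by
    have h4 := IsGaussian.memLp_id (gaussianReal 0 1) 4 (by norm_num)
    have := h4.norm_rpow_div 2
    have h42 : (4 : ENNReal) / 2 = 2 := by
      rw [show (4 : ENNReal) = 2 * 2 by norm_num,
        ENNReal.mul_div_cancel_right (by norm_num) (by norm_num)]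
    simpa [h42] using this
  have hmean : ∫ x, x ^ 2 ∂gaussianReal 0 1 = 1 := by
    have h1 := variance_eq_integral (μ := gaussianReal 0 1) (X := id) (by fun_prop)
    simp only [id, integral_id_gaussianReal, sub_zero] at h1
    rw [← h1]
    simp [variance_id_gaussianReal]
  set ν := Measure.pi fun _ : Fin d => gaussianReal 0 1 with hν
  set F : (Fin d → ℝ) → ℝ := ∑ i, fun x : Fin d → ℝ => x i ^ 2 with hF
  have hmemi : ∀ i : Fin d, MemLp (fun x : Fin d → ℝ => x i ^ 2) 2 ν := fun i =>
    hmem.comp_measurePreserving (measurePreserving_eval _ i)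
  have hFm : MemLp F 2 ν := memLp_finsetSum' _ fun i _ => hmemi i
  have hFv : Var[F; ν] = d * V := by
    rw [hF, hν, variance_sum_pi (fun _ => hmem)]
    simp [hV]
  have hFi : ∫ x, F x ∂ν = d := by
    have : ∀ i : Fin d, ∫ x : Fin d → ℝ, x i ^ 2 ∂ν = 1 := fun i => by
      rw [← hmean, ← (measurePreserving_eval (fun _ : Fin d => gaussianReal 0 1) i).map_eq,
        integral_map (measurable_pi_apply i).aemeasurable (by fun_prop)]
    simp only [hF, Finset.sum_apply]
    rw [integral_finsetSum _ fun i _ => (hmemi i).integrable (by norm_num)]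
    simp [this]
  have hch := meas_ge_le_variance_div_sq hFm (c := d / 2) (by positivity)
  rw [hFi, hFv] at hch
  rw [← map_pi_eq_stdGaussian, map_measureReal_apply (by fun_prop)
    (measurableSet_lt (by fun_prop) (by fun_prop))]
  have hsub : (WithLp.toLp 2 ⁻¹' {x : E d | ‖x‖ ^ 2 < d / 2} : Set (Fin d → ℝ))
      ⊆ {x | d / 2 ≤ |F x - d|} := by
    intro x hx
    have hx' : F x < d / 2 := by
      simpa [EuclideanSpace.real_norm_sq_eq, hF] using hx
    change (d : ℝ) / 2 ≤ |F x - d|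
    rw [le_abs]
    right; linarith
  refine (measureReal_mono hsub).trans ?_
  refine (ENNReal.toReal_mono ENNReal.ofReal_ne_top hch).trans ?_
  rw [ENNReal.toReal_ofReal (by positivity), div_le_div_iff₀ (by positivity) (by norm_num)]
  nlinarith

variable {d : ℕ}

theorem lintegral_inner_sq_stdGaussian (x : E d) :
    ∫⁻ y, ENNReal.ofReal (inner ℝ x y ^ 2) ∂stdGaussian (E d) = ENNReal.ofReal (‖x‖ ^ 2) := by
  have hm : MemLp (innerSL ℝ x) 2 (stdGaussian (E d)) := IsGaussian.memLp_dual _ _ _ (by norm_num)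
  have h1 := ofReal_variance hm
  rw [evariance_eq_lintegral_ofReal, integral_strongDual_stdGaussian, variance_dual_stdGaussian,
    innerSL_apply_norm] at h1
  simpa using h1.symm

theorem lintegral_norm_sq_stdGaussian :
    ∫⁻ x, ENNReal.ofReal (‖x‖ ^ 2) ∂stdGaussian (E d) = d := by
  have h : ∀ x : E d, ENNReal.ofReal (‖x‖ ^ 2)
      = ∑ i, ENNReal.ofReal (inner ℝ (EuclideanSpace.basisFun (Fin d) ℝ i) x ^ 2) := fun x => by
    rw [← ENNReal.ofReal_sum_of_nonneg fun _ _ => sq_nonneg _,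
      (EuclideanSpace.basisFun (Fin d) ℝ).sum_sq_inner_right]
  simp_rw [h]
  rw [lintegral_finsetSum _ fun i _ => by fun_prop]
  simp [lintegral_inner_sq_stdGaussian]

variable {κ : Type*} [Fintype κ] [DecidableEq κ]

theorem lintegral_inner_sq_stdFamily {p i : κ} (hpi : p ≠ i) :
    ∫⁻ Y, ENNReal.ofReal (inner ℝ (Y p) (Y i) ^ 2) ∂stdFamily κ d = d := by
  have h1 := measurePreserving_reindex (d := d) ![p, i] (fun a b => by
    fin_cases a <;> fin_cases b <;> simp [hpi, hpi.symm])
  have h2 := (measurePreserving_finTwoArrow (stdGaussian (E d))).comp h1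
  have h3 := h2.lintegral_comp (f := fun z : E d × E d => ENNReal.ofReal (inner ℝ z.1 z.2 ^ 2))
    (by fun_prop)
  refine Eq.trans ?_ (h3.trans ?_)
  · rfl
  · rw [lintegral_prod _ (by fun_prop)]
    simp_rw [lintegral_inner_sq_stdGaussian]
    exact lintegral_norm_sq_stdGaussian

theorem measureReal_sum_inner_sq_le (hd : 0 < d) {s : Finset κ} (hs : 0 < s.card) {p : κ}
    (hp : p ∉ s) :
    (stdFamily κ d).real {Y | 100 * (d * s.card) ≤ ∑ i ∈ s, inner ℝ (Y p) (Y i) ^ 2} ≤ 1 / 100 := by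
  have h1 := mul_meas_ge_le_lintegral (μ := stdFamily κ d)
    (f := fun Y : κ → E d => ∑ i ∈ s, ENNReal.ofReal (inner ℝ (Y p) (Y i) ^ 2)) (by fun_prop)
    (100 * (d * s.card))
  rw [lintegral_finsetSum _ fun i _ => by fun_prop, Finset.sum_congr rfl fun i hi =>
    lintegral_inner_sq_stdFamily (d := d) (fun h : p = i => hp (h ▸ hi))] at h1
  have hset : {Y : κ → E d | 100 * (d * s.card) ≤ ∑ i ∈ s, inner ℝ (Y p) (Y i) ^ 2}
      = {Y | (100 * (d * s.card) : ENNReal) ≤ ∑ i ∈ s, ENNReal.ofReal (inner ℝ (Y p) (Y i) ^ 2)} := by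
    ext Y
    rw [Set.mem_ofPred_eq, Set.mem_ofPred_eq, ← ENNReal.ofReal_sum_of_nonneg fun _ _ => sq_nonneg _]
    have : (100 * (d * s.card) : ENNReal) = ENNReal.ofReal (100 * (d * s.card)) := by
      rw [ENNReal.ofReal_mul (by norm_num), ENNReal.ofReal_mul (by positivity)]
      simp
    rw [this, ENNReal.ofReal_le_ofReal_iff (Finset.sum_nonneg fun _ _ => sq_nonneg _)]
  rw [hset]
  have h2 := ENNReal.toReal_mono (by simp [ENNReal.mul_eq_top]) h1
  simp only [ENNReal.toReal_mul, Finset.sum_const, nsmul_eq_mul, ENNReal.toReal_natCast] at h2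
  norm_num at h2
  have h3 : (0 : ℝ) < d * s.card := by positivity
  change _ * ((stdFamily κ d).real _) ≤ _ at h2
  set P := (stdFamily κ d).real
    {Y | (100 * (d * s.card) : ENNReal) ≤ ∑ i ∈ s, ENNReal.ofReal (inner ℝ (Y p) (Y i) ^ 2)}
  by_contra hP
  push Not at hP
  nlinarith

/-- For a standard Gaussian vector `a` and an independent scatter matrix `B` of `N` such vectors,
`aᵀ B⁻¹ a` is at least of order `d / N`. -/
theorem exists_measureReal_diag_le : ∃ d₀ : ℝ, 1 ≤ d₀ ∧ ∀ (d : ℕ), d₀ ≤ d →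
    ∀ {κ : Type} [Fintype κ] [DecidableEq κ] {s : Finset κ} {p : κ}, d ≤ s.card → p ∉ s →
    (stdFamily κ d).real {Y | invForm (scatter s Y) (Y p) (Y p) < d / (400 * s.card)}
      ≤ 3 / 100 := by
  obtain ⟨d₀, hd₀, H⟩ := exists_measureReal_norm_sq_lt_le
  refine ⟨d₀, hd₀, fun d hd κ _ _ s p hs hp => ?_⟩
  have hd1 : (1 : ℝ) ≤ d := hd₀.trans hd
  have hd' : 0 < d := by exact_mod_cast (by linarith : (0 : ℝ) < d)
  have hsN : (d : ℝ) ≤ s.card := by exact_mod_cast hs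
  have h1 := measureReal_sum_inner_sq_le (d := d) hd' (hd'.trans_le hs) hp
  have h2 : (stdFamily κ d).real {Y | ‖Y p‖ ^ 2 < d / 2} ≤ 1 / 50 := by
    have := (measurePreserving_eval (fun _ : κ => stdGaussian (E d)) p).measureReal_preimage
      (s := {x | ‖x‖ ^ 2 < d / 2})
      (measurableSet_lt (by fun_prop) (by fun_prop)).nullMeasurableSet
    exact this.le.trans (H d hd)
  set A1 : Set (κ → E d) := {Y | 100 * (d * s.card) ≤ ∑ i ∈ s, inner ℝ (Y p) (Y i) ^ 2}
  set A2 : Set (κ → E d) := {Y | ‖Y p‖ ^ 2 < d / 2}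
  have hsub : {Y | invForm (scatter s Y) (Y p) (Y p) < d / (400 * s.card)}
      ≤ᵐ[stdFamily κ d] (A1 ∪ A2 : Set (κ → E d)) := by
    filter_upwards [ae_det_scatter_ne_zero (d := d) s hs] with Y hY hbad
    by_contra hgood
    have hg1 : ¬ 100 * (d * s.card) ≤ ∑ i ∈ s, inner ℝ (Y p) (Y i) ^ 2 :=
      fun h => hgood (Or.inl h)
    have hg2 : ¬ ‖Y p‖ ^ 2 < d / 2 := fun h => hgood (Or.inr h)
    push Not at hg1 hg2
    have hb : invForm (scatter s Y) (Y p) (Y p) < d / (400 * s.card) := hbad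
    have h4 := norm_pow_four_le_of_scatter hY (Y p)
    have h5 : (d / 2 : ℝ) ^ 2 ≤ (‖Y p‖ ^ 2) ^ 2 := by gcongr
    have h0 := invForm_scatter_nonneg s Y (Y p)
    have h6 : (d / 2 : ℝ) ^ 2 ≤ 100 * (d * s.card) * invForm (scatter s Y) (Y p) (Y p) :=
      (h5.trans h4).trans (by gcongr)
    rw [lt_div_iff₀ (by linarith)] at hb
    nlinarith
  calc (stdFamily κ d).real {Y | invForm (scatter s Y) (Y p) (Y p) < d / (400 * s.card)}
      ≤ (stdFamily κ d).real (A1 ∪ A2) :=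
        ENNReal.toReal_mono (measure_ne_top _ _) (measure_mono_ae hsub)
    _ ≤ (stdFamily κ d).real A1 + (stdFamily κ d).real A2 := measureReal_union_le _ _
    _ ≤ 3 / 100 := by linarith

end

/-! ### Inverse empirical covariance matrices -/

section

variable {κ : Type*} [Fintype κ] {d : ℕ}

/-- The empirical covariance matrix of a finite family of vectors. -/
noncomputable def sampleCov (y : κ → E d) : Matrix (Fin d) (Fin d) ℝ :=
  (Fintype.card κ : ℝ)⁻¹ • ∑ i,
    vecMulVec (y i - (Fintype.card κ : ℝ)⁻¹ • ∑ j, y j).ofLp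
      (y i - (Fintype.card κ : ℝ)⁻¹ • ∑ j, y j).ofLp

theorem invForm_smul_left (c : ℝ) (B : Matrix (Fin d) (Fin d) ℝ) (u v : E d) :
    invForm (c • B) u v = c⁻¹ * invForm B u v := by
  rcases eq_or_ne c 0 with rfl | hc
  · simp [invForm]
  · by_cases h : IsUnit B.det
    · have := invertibleOfNonzero hc
      rw [invForm, Matrix.inv_smul (A := B) c h, smul_mulVec, dotProduct_smul, invForm, smul_eq_mul,
        invOf_eq_inv]
    · have h' : ¬ IsUnit (c • B).det := by
        rw [det_smul]
        simpa [hc] using h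
      simp [invForm, nonsing_inv_apply_not_isUnit _ h, nonsing_inv_apply_not_isUnit _ h']

theorem invForm_smul_smul (B : Matrix (Fin d) (Fin d) ℝ) (a b : ℝ) (u v : E d) :
    invForm B (a • u) (b • v) = a * b * invForm B u v := by
  simp [invForm, mulVec_smul, mul_assoc]
  ring

theorem invForm_add_left (B : Matrix (Fin d) (Fin d) ℝ) (u u' v : E d) :
    invForm B (u + u') v = invForm B u v + invForm B u' v := by
  simp [invForm, add_dotProduct]

theorem invForm_sub_right (B : Matrix (Fin d) (Fin d) ℝ) (u v v' : E d) :
    invForm B u (v - v') = invForm B u v - invForm B u v' := by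
  simp [invForm, mulVec_sub, dotProduct_sub]

end

/-- Centering costs one degree of freedom: an orthogonal matrix whose first row is constant turns
the centered scatter of `N + 1` vectors into the uncentered scatter of `N` combinations. -/
theorem exists_orthogonal_sampleCov (N d : ℕ) : ∃ b : Fin (N + 1) → Fin (N + 1) → ℝ,
    (∀ k l, ∑ i, b k i * b l i = if k = l then 1 else 0) ∧
    ∀ y : Fin (N + 1) → E d, sampleCov y
      = ((N : ℝ) + 1)⁻¹ • scatter (Finset.univ.erase 0) (fun k => ∑ i, b k i • y i) := by
  have hM : (0 : ℝ) < (N : ℝ) + 1 := by positivity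
  set u : EuclideanSpace ℝ (Fin (N + 1)) := WithLp.toLp 2 fun _ => (√((N : ℝ) + 1))⁻¹ with hu
  have hu1 : ‖u‖ = 1 := by
    have : ‖u‖ ^ 2 = 1 := by
      rw [EuclideanSpace.real_norm_sq_eq]
      simp [hu, Real.sq_sqrt hM.le, hM.ne']
    exact (pow_eq_one_iff_of_nonneg (norm_nonneg _) two_ne_zero).1 this
  obtain ⟨b, hb⟩ := Orthonormal.exists_orthonormalBasis_extension_of_card_eq (𝕜 := ℝ)
    (E := EuclideanSpace ℝ (Fin (N + 1))) (ι := Fin (N + 1)) (by simp) (v := fun _ => u)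
    (s := {0}) (by
      rw [orthonormal_iff_ite]
      rintro ⟨i, hi⟩ ⟨j, hj⟩
      simp only [Set.mem_singleton_iff] at hi hj
      subst hi hj
      simp [hu1])
  have hb0 : ∀ i, b 0 i = (√((N : ℝ) + 1))⁻¹ := fun i => by
    rw [hb 0 rfl]
  refine ⟨fun k i => b k i, fun k l => ?_, fun y => ?_⟩
  · rw [← orthonormal_iff_ite.1 b.orthonormal k l, PiLp.inner_apply]
    simp [mul_comm]
  · have hcol : ∀ i j, ∑ k, b k i * b k j = if i = j then 1 else 0 := fun i j => by
      have := b.sum_inner_mul_inner (EuclideanSpace.basisFun _ ℝ i) (EuclideanSpace.basisFun _ ℝ j)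
      rw [orthonormal_iff_ite.1 (EuclideanSpace.basisFun (Fin (N + 1)) ℝ).orthonormal i j] at this
      rw [← this]
      simp [PiLp.inner_apply]
    rw [sampleCov, Fintype.card_fin, Nat.cast_succ]
    congr 1
    have hfull : scatter Finset.univ (fun k => ∑ i, b k i • y i)
        = scatter Finset.univ y := by
      ext r c
      simp only [scatter, Matrix.sum_apply, vecMulVec_apply, WithLp.ofLp_sum, WithLp.ofLp_smul,
        Finset.sum_apply, Pi.smul_apply, smul_eq_mul, Finset.sum_mul_sum]
      rw [Finset.sum_comm]
      refine Finset.sum_congr rfl fun i _ => ?_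
      rw [Finset.sum_comm]
      have : ∀ j, ∑ k, b k i * (y i).ofLp r * (b k j * (y j).ofLp c)
          = (if i = j then 1 else 0) * ((y i).ofLp r * (y j).ofLp c) := fun j => by
        rw [← hcol i j, Finset.sum_mul]
        exact Finset.sum_congr rfl fun k _ => by ring
      simp [this]
    have hins := scatter_insert (Finset.notMem_erase (0 : Fin (N + 1)) Finset.univ)
      (fun k => ∑ i, b k i • y i)
    rw [Finset.insert_erase (Finset.mem_univ _), hfull] at hins
    rw [← sub_eq_iff_eq_add'.2 hins]
    have hsq : (√((N : ℝ) + 1))⁻¹ * (√((N : ℝ) + 1))⁻¹ = ((N : ℝ) + 1)⁻¹ := by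
      rw [← mul_inv, Real.mul_self_sqrt hM.le]
    ext r c
    simp only [scatter, Matrix.sum_apply, Matrix.sub_apply, vecMulVec_apply, WithLp.ofLp_sum,
      WithLp.ofLp_smul, WithLp.ofLp_sub, Finset.sum_apply, Pi.smul_apply, Pi.sub_apply, smul_eq_mul,
      hb0, ← Finset.mul_sum]
    set R := ∑ i, (y i).ofLp r
    set Cc := ∑ i, (y i).ofLp c
    have e : ∀ i, ((y i).ofLp r - ((N : ℝ) + 1)⁻¹ * R) * ((y i).ofLp c - ((N : ℝ) + 1)⁻¹ * Cc)
        = (y i).ofLp r * (y i).ofLp c - (((N : ℝ) + 1)⁻¹ * Cc) * (y i).ofLp r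
          - (((N : ℝ) + 1)⁻¹ * R) * (y i).ofLp c
          + ((N : ℝ) + 1)⁻¹ * R * (((N : ℝ) + 1)⁻¹ * Cc) := fun i => by ring
    simp only [e, Finset.sum_add_distrib, Finset.sum_sub_distrib, ← Finset.mul_sum,
      Finset.sum_const, Finset.card_univ, Fintype.card_fin, nsmul_eq_mul]
    have e2 : (√((N : ℝ) + 1))⁻¹ * R * ((√((N : ℝ) + 1))⁻¹ * Cc) = ((N : ℝ) + 1)⁻¹ * (R * Cc) := by
      rw [← hsq]; ring
    rw [e2]
    push_cast
    field_simp
    ring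

section

variable {ι : Type} [Fintype ι] [DecidableEq ι] {d N : ℕ}

/-- The empirical covariance of the vectors with index in the range of `e`, together with
orthonormal combinations `w` of the other vectors, has the joint law of a scatter matrix and
independent standard Gaussian vectors. -/
theorem exists_measurePreserving_sampleCov {ρ : Type} [Fintype ρ] [DecidableEq ρ]
    (e : Fin (N + 1) → ι) (he : Function.Injective e) (w : ρ → ι → ℝ)
    (hw : ∀ k l, ∑ i, w k i * w l i = if k = l then 1 else 0) (hwe : ∀ k j, w k (e j) = 0) :
    ∃ Φ : (ι → E d) → (Fin (N + 1) ⊕ ρ → E d),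
      MeasurePreserving Φ (stdFamily ι d) (stdFamily (Fin (N + 1) ⊕ ρ) d) ∧
      ∀ g, (∀ r, Φ g (Sum.inr r) = ∑ i, w r i • g i) ∧
        sampleCov (fun j => g (e j))
          = ((N : ℝ) + 1)⁻¹ • scatter ((Finset.univ.erase 0).map Function.Embedding.inl) (Φ g) := by
  obtain ⟨b, hb, hb'⟩ := exists_orthogonal_sampleCov N d
  have h1 := measurePreserving_comb (d := d)
    (Sum.elim (fun j i => if i = e j then (1 : ℝ) else 0) w : Fin (N + 1) ⊕ ρ → ι → ℝ) (by
      rintro (k | k) (l | l)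
      · simp [he.eq_iff, eq_comm]
      · simp [hwe]
      · simp [hwe]
      · simp [hw])
  have h2 := measurePreserving_comb (d := d)
    (Sum.elim (fun k => Sum.elim (b k) 0) (fun r => Sum.elim 0 (fun r' => if r' = r then 1 else 0)) :
      Fin (N + 1) ⊕ ρ → Fin (N + 1) ⊕ ρ → ℝ) (by
      rintro (k | k) (l | l)
      · simp [hb]
      · simp
      · simp
      · simp [eq_comm])
  refine ⟨_, h2.comp h1, fun g => ⟨fun r => ?_, ?_⟩⟩
  · simp [Fintype.sum_sum_type, ite_smul]
  · rw [hb']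
    congr 1
    simp only [scatter, Finset.sum_map]
    refine Finset.sum_congr rfl fun k _ => ?_
    simp [Fintype.sum_sum_type, ite_smul]

/-- Two orthogonal combinations of the vectors outside the covariance sample have a small inner
product in the inverse empirical covariance. -/
theorem measureReal_sampleCov_cross_le (hd : 0 < d) (hN : 1000 * d ≤ N) (e : Fin (N + 1) → ι)
    (he : Function.Injective e) {u v : ι → ℝ} (hu : ∀ j, u (e j) = 0) (hv : ∀ j, v (e j) = 0)
    {α β : ℝ} (hα : 0 < α) (hβ : 0 < β) (huα : ∑ i, u i ^ 2 = α ^ 2) (hvβ : ∑ i, v i ^ 2 = β ^ 2)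
    (huv : ∑ i, u i * v i = 0) :
    (stdFamily ι d).real {g | 40 * √d * (α * β) <
      |invForm (sampleCov fun j => g (e j)) (∑ i, u i • g i) (∑ i, v i • g i)|} ≤ 1 / 50 := by
  obtain ⟨Φ, hΦ, hg⟩ := exists_measurePreserving_sampleCov (d := d) e he
    ![fun i => α⁻¹ * u i, fun i => β⁻¹ * v i] (by
      have h1 : ∑ i, α⁻¹ * u i * (α⁻¹ * u i) = 1 := by
        have : ∀ i, α⁻¹ * u i * (α⁻¹ * u i) = (α ^ 2)⁻¹ * u i ^ 2 := fun i => by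
          field_simp
        simp_rw [this, ← Finset.mul_sum, huα]
        field_simp
      have h2 : ∑ i, β⁻¹ * v i * (β⁻¹ * v i) = 1 := by
        have : ∀ i, β⁻¹ * v i * (β⁻¹ * v i) = (β ^ 2)⁻¹ * v i ^ 2 := fun i => by
          field_simp
        simp_rw [this, ← Finset.mul_sum, hvβ]
        field_simp
      have h3 : ∑ i, α⁻¹ * u i * (β⁻¹ * v i) = 0 := by
        have : ∀ i, α⁻¹ * u i * (β⁻¹ * v i) = (α⁻¹ * β⁻¹) * (u i * v i) := fun i => by ring
        simp_rw [this, ← Finset.mul_sum, huv, mul_zero]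
      have h4 : ∑ i, β⁻¹ * v i * (α⁻¹ * u i) = 0 := by
        rw [← h3]
        exact Finset.sum_congr rfl fun i _ => mul_comm _ _
      intro k l
      fin_cases k <;> fin_cases l <;> simp [h1, h2, h3, h4]) (by
      intro k j
      fin_cases k <;> simp [hu, hv])
  set s := (Finset.univ.erase (0 : Fin (N + 1))).map (Function.Embedding.inl (β := Fin 2))
  have hs : s.card = N := by simp [s]
  have key := measureReal_cross_le (d := d) hd (s := s) (by omega) (p := Sum.inr 0) (q := Sum.inr 1)
    (by simp [s]) (by simp [s]) (by simp)
  have hms : MeasurableSet {Y : Fin (N + 1) ⊕ Fin 2 → E d | 20 * √d / s.card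
      < |invForm (scatter s Y) (Y (Sum.inr 0)) (Y (Sum.inr 1))|} :=
    measurableSet_lt measurable_const
      (measurable_invForm_scatter s (Sum.inr 0) (Sum.inr 1)).norm
  rw [← hΦ.measureReal_preimage hms.nullMeasurableSet] at key
  refine (measureReal_mono fun g hgb => ?_).trans key
  have hgb' : 40 * √d * (α * β) <
      |invForm (sampleCov fun j => g (e j)) (∑ i, u i • g i) (∑ i, v i • g i)| := hgb
  obtain ⟨h1, h2⟩ := hg g
  have hu' : ∑ i, u i • g i = α • Φ g (Sum.inr 0) := by
    rw [h1 0, Finset.smul_sum]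
    refine Finset.sum_congr rfl fun i _ => ?_
    simp [smul_smul, hα.ne']
  have hv' : ∑ i, v i • g i = β • Φ g (Sum.inr 1) := by
    rw [h1 1, Finset.smul_sum]
    refine Finset.sum_congr rfl fun i _ => ?_
    simp [smul_smul, hβ.ne']
  rw [h2, hu', hv', invForm_smul_smul, invForm_smul_left, inv_inv, abs_mul (α * β),
    abs_mul ((N : ℝ) + 1),
    abs_of_pos (mul_pos hα hβ), abs_of_pos (by positivity : (0 : ℝ) < (N : ℝ) + 1)] at hgb'
  change 20 * √d / s.card < |invForm (scatter s (Φ g)) (Φ g (Sum.inr 0)) (Φ g (Sum.inr 1))|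
  have hN1 : (1 : ℝ) ≤ N := by exact_mod_cast (by omega : 1 ≤ N)
  rw [hs, div_lt_iff₀ (by linarith)]
  set T := |invForm (scatter s (Φ g)) (Φ g (Sum.inr 0)) (Φ g (Sum.inr 1))|
  have hT : 0 ≤ T := abs_nonneg _
  have hαβ : 0 < α * β := mul_pos hα hβ
  have h3 : 40 * √d < ((N : ℝ) + 1) * T := by
    rw [mul_comm] at hgb'
    exact lt_of_mul_lt_mul_left hgb' hαβ.le
  nlinarith

/-- A vector outside the covariance sample has a large norm in the inverse empirical
covariance. -/
theorem exists_measureReal_sampleCov_diag_le : ∃ d₀ : ℝ, 1 ≤ d₀ ∧ ∀ (d N : ℕ), d₀ ≤ d → d ≤ N →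
    ∀ {ι : Type} [Fintype ι] [DecidableEq ι] (e : Fin (N + 1) → ι), Function.Injective e →
    ∀ p : ι, (∀ j, e j ≠ p) →
    (stdFamily ι d).real
      {g | invForm (sampleCov fun j => g (e j)) (g p) (g p) < d / 400} ≤ 3 / 100 := by
  obtain ⟨d₀, hd₀, H⟩ := exists_measureReal_diag_le
  refine ⟨d₀, hd₀, fun d N hd hN ι _ _ e he p hp => ?_⟩
  have hd1 : (1 : ℝ) ≤ d := hd₀.trans hd
  obtain ⟨Φ, hΦ, hg⟩ := exists_measurePreserving_sampleCov (d := d) e he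
    (fun _ : Unit => fun i => if i = p then (1 : ℝ) else 0) (by simp) (by simp [hp])
  set s := (Finset.univ.erase (0 : Fin (N + 1))).map (Function.Embedding.inl (β := Unit))
  have hs : s.card = N := by simp [s]
  have key := H d hd (s := s) (p := Sum.inr ()) (by omega) (by simp [s])
  have hms : MeasurableSet {Y : Fin (N + 1) ⊕ Unit → E d |
      invForm (scatter s Y) (Y (Sum.inr ())) (Y (Sum.inr ())) < d / (400 * s.card)} :=
    measurableSet_lt (measurable_invForm_scatter s (Sum.inr ()) (Sum.inr ())) measurable_const
  rw [← hΦ.measureReal_preimage hms.nullMeasurableSet] at key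
  refine (measureReal_mono fun g hgb => ?_).trans key
  have hgb' : invForm (sampleCov fun j => g (e j)) (g p) (g p) < d / 400 := hgb
  obtain ⟨h1, h2⟩ := hg g
  have hp' : g p = Φ g (Sum.inr ()) := by
    rw [h1 ()]; simp [ite_smul]
  rw [h2, invForm_smul_left, inv_inv, hp'] at hgb'
  change invForm (scatter s (Φ g)) (Φ g (Sum.inr ())) (Φ g (Sum.inr ())) < d / (400 * s.card)
  have hN1 : (1 : ℝ) ≤ N := hd1.trans (by exact_mod_cast hN)
  have h0 := invForm_scatter_nonneg s (Φ g) (Φ g (Sum.inr ()))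
  rw [hs, lt_div_iff₀ (by linarith)]
  nlinarith

end

/-! ### Gaussian data and estimators that see only the empirical mean -/

section

open scoped MatrixOrder

variable {d : ℕ}

/-- The affine map `x ↦ μ + R x` of `ℝ^d`. -/
noncomputable def affineMap (μ : E d) (R : Matrix (Fin d) (Fin d) ℝ) (x : E d) : E d :=
  μ + toEuclideanCLM (𝕜 := ℝ) R x

theorem continuous_affineMap (μ : E d) (R : Matrix (Fin d) (Fin d) ℝ) :
    Continuous (affineMap μ R) := by
  unfold affineMap
  fun_prop

theorem transpose_sqrt (S : Matrix (Fin d) (Fin d) ℝ) : (CFC.sqrt S)ᵀ = CFC.sqrt S := by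
  have h := (CFC.sqrt_nonneg S).isSelfAdjoint
  rw [← conjTranspose_eq_transpose_of_trivial]
  exact h

theorem sqrt_mul_sqrt {S : Matrix (Fin d) (Fin d) ℝ} (hS : S.PosDef) :
    CFC.sqrt S * CFC.sqrt S = S := by
  exact CFC.sqrt_mul_sqrt_self _ hS.posSemidef.nonneg

theorem det_sqrt_ne_zero {S : Matrix (Fin d) (Fin d) ℝ} (hS : S.PosDef) :
    (CFC.sqrt S).det ≠ 0 := by
  intro h
  have := congrArg det (sqrt_mul_sqrt hS)
  rw [det_mul, h, mul_zero] at this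
  exact hS.det_pos.ne this

theorem exists_of_mem_gaussianFamily {D : ProbabilityMeasure (E d)} (hD : D ∈ gaussianFamily d) :
    ∃ (μ : E d) (S : Matrix (Fin d) (Fin d) ℝ), S.PosDef ∧ covMatrix D = S ∧
      (D : Measure (E d)) = (stdGaussian (E d)).map (affineMap μ (CFC.sqrt S)) := by
  obtain ⟨μ, S, hS, h⟩ := hD
  refine ⟨μ, S, hS, ?_, h⟩
  ext i j
  rw [covMatrix, h, Matrix.of_apply, covariance_eval_multivariateGaussian hS.posSemidef]

/-- The family contains the translates and dilates of each of its members. -/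
theorem exists_scaled_mem_gaussianFamily {S : Matrix (Fin d) (Fin d) ℝ} (hS : S.PosDef) (ν : E d)
    {ε : ℝ} (hε : 0 < ε) : ∃ D ∈ gaussianFamily d, covMatrix D = ε • S ∧
      (D : Measure (E d)) = (stdGaussian (E d)).map (affineMap ν (√ε • CFC.sqrt S)) := by
  have hεS : (ε • S).PosDef := hS.smul hε
  have hsqrt : CFC.sqrt (ε • S) = √ε • CFC.sqrt S := by
    refine CFC.sqrt_unique ?_ ?_
    · rw [smul_mul_smul_comm, Real.mul_self_sqrt hε.le, sqrt_mul_sqrt hS]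
    · have h := (Matrix.nonneg_iff_posSemidef.1 (CFC.sqrt_nonneg S)).smul (Real.sqrt_nonneg ε)
      exact h.nonneg
  have hD : (⟨multivariateGaussian ν (ε • S), inferInstance⟩ : ProbabilityMeasure (E d))
      ∈ gaussianFamily d := ⟨ν, ε • S, hεS, rfl⟩
  refine ⟨_, hD, ?_, ?_⟩
  · ext i j
    exact covariance_eval_multivariateGaussian hεS.posSemidef i j
  · rw [← hsqrt]
    rfl

theorem measurePreserving_sum_smul {ι : Type*} [Fintype ι] (a : ι → ℝ) (ha : ∑ i, a i * a i = 1) :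
    MeasurePreserving (fun g : ι → E d => ∑ i, a i • g i) (stdFamily ι d) (stdGaussian (E d)) :=
  (measurePreserving_eval (fun _ : Unit => stdGaussian (E d)) ()).comp
    (measurePreserving_comb (d := d) (fun _ : Unit => a) (fun _ _ => by simp [ha]))

theorem empMean_affineMap {n : ℕ} [NeZero n] (μ : E d) (R : Matrix (Fin d) (Fin d) ℝ)
    (g : Fin n → E d) :
    empMean (fun i => affineMap μ R (g i)) = affineMap μ R (empMean g) := by
  have hn : (n : ℝ) ≠ 0 := Nat.cast_ne_zero.2 (NeZero.ne n)
  simp only [empMean, affineMap, Finset.sum_add_distrib, smul_add, Finset.sum_const,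
    Finset.card_univ, Fintype.card_fin, map_smul, map_sum]
  rw [← Nat.cast_smul_eq_nsmul ℝ, smul_smul, inv_mul_cancel₀ hn, one_smul]

theorem measurePreserving_affineMap_pi {D : ProbabilityMeasure (E d)} {μ : E d}
    {R : Matrix (Fin d) (Fin d) ℝ}
    (hD : (D : Measure (E d)) = (stdGaussian (E d)).map (affineMap μ R)) (κ : Type*) [Fintype κ] :
    MeasurePreserving (fun (g : κ → E d) i => affineMap μ R (g i)) (stdFamily κ d)
      (Measure.pi fun _ : κ => (D : Measure (E d))) :=
  measurePreserving_pi _ _ fun _ => ⟨(continuous_affineMap μ R).measurable, hD.symm⟩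

/-- The joint law of the empirical mean and the estimate, for an estimator that sees only the
empirical mean. -/
theorem compProd_comap_empMean_apply {n : ℕ} [NeZero n] (K : Kernel (E d) (E d)) [IsMarkovKernel K]
    {D : ProbabilityMeasure (E d)} {μ : E d} {R : Matrix (Fin d) (Fin d) ℝ}
    (hD : (D : Measure (E d)) = (stdGaussian (E d)).map (affineMap μ R))
    {B : Set (E d × E d)} (hB : MeasurableSet B) :
    ((Measure.pi fun _ : Fin n => (D : Measure (E d))) ⊗ₘ K.comap empMean measurable_empMean)
        {p | (empMean p.1, p.2) ∈ B}
      = ∫⁻ z, K (affineMap μ R ((√n)⁻¹ • z)) (Prod.mk (affineMap μ R ((√n)⁻¹ • z)) ⁻¹' B)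
          ∂stdGaussian (E d) := by
  have hn : (0 : ℝ) < n := Nat.cast_pos.2 (Nat.pos_of_ne_zero (NeZero.ne n))
  have hm : Measurable fun p : (Fin n → E d) × E d => (empMean p.1, p.2) :=
    (measurable_empMean.comp measurable_fst).prodMk measurable_snd
  have hf : Measurable fun z : E d => K z (Prod.mk z ⁻¹' B) :=
    Kernel.measurable_kernel_prodMk_left hB
  have haff : Measurable fun z : E d => affineMap μ R ((√n)⁻¹ • z) :=
    (continuous_affineMap μ R).measurable.comp (measurable_const_smul _)
  have h1 := (measurePreserving_affineMap_pi hD (Fin n)).lintegral_comp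
    (f := fun x => K (empMean x) (Prod.mk (empMean x) ⁻¹' B)) (hf.comp measurable_empMean)
  have h2 := (measurePreserving_sum_smul (d := d) (fun _ : Fin n => (√n)⁻¹) (by
    rw [Finset.sum_const, Finset.card_univ, Fintype.card_fin, nsmul_eq_mul, ← mul_inv,
      Real.mul_self_sqrt hn.le, mul_inv_cancel₀ hn.ne'])).lintegral_comp (hf.comp haff)
  have h3 := Measure.compProd_apply (μ := Measure.pi fun _ : Fin n => (D : Measure (E d)))
    (κ := K.comap empMean measurable_empMean) (hm hB)
  refine h3.trans ?_
  refine Eq.trans (Eq.trans h1.symm (lintegral_congr fun g => ?_)) h2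
  have hg : empMean (fun i => affineMap μ R (g i))
      = affineMap μ R ((√n)⁻¹ • ∑ i, (√n)⁻¹ • g i) := by
    rw [empMean_affineMap, ← Finset.smul_sum, smul_smul, ← mul_inv, Real.mul_self_sqrt hn.le]
    rfl
  simp only [hg, Function.comp]

/-- An estimator of the class `symmetricClass` returns the empirical mean itself with probability at
least `0.99`. Indeed `N(μ, Σ)` is a mixture of the narrow Gaussians `N(ν, ε Σ)`, for which the
accuracy requirement is on the scale `√ε`, so that the accuracy holds for `N(μ, Σ)` on every
scale. -/
theorem le_measureReal_eq_empMean {n : ℕ} [NeZero n] {ρ : ℝ} {A : MeanEstimator d n}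
    (hA : A ∈ symmetricClass n d ρ) {D : ProbabilityMeasure (E d)} (hD : D ∈ gaussianFamily d) :
    0.99 ≤ ((Measure.pi fun _ : Fin n => (D : Measure (E d))) ⊗ₘ A.kernel D).real
      {p | p.2 = empMean p.1} := by
  obtain ⟨K, hK, hAK, hacc⟩ := hA
  obtain ⟨μ, S, hS, -, hDμ⟩ := exists_of_mem_gaussianFamily hD
  set Q : E d → ℝ := fun v => v.ofLp ⬝ᵥ S⁻¹ *ᵥ v.ofLp with hQ
  have hQc : Continuous Q := by
    have h1 : Continuous fun v : E d => v.ofLp := by fun_prop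
    exact h1.dotProduct (continuous_const.matrix_mulVec h1)
  let B : ℝ → Set (E d × E d) := fun δ => {p | Q (p.2 - p.1) ≤ δ}
  have hB : ∀ δ, MeasurableSet (B δ) := fun δ =>
    (isClosed_le (hQc.comp (continuous_snd.sub continuous_fst)) continuous_const).measurableSet
  let φ : ℝ → E d → ENNReal := fun δ z => K z (Prod.mk z ⁻¹' B δ)
  have hφ : ∀ δ, Measurable (φ δ) := fun δ => Kernel.measurable_kernel_prodMk_left (hB δ)
  -- The accuracy requirement for the narrow Gaussian `N(ν, ε Σ)`.
  have hnarrow : ∀ ε : ℝ, 0 < ε → ∀ ν : E d, ENNReal.ofReal 0.99 ≤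
      ∫⁻ z, φ (2 * ρ ^ 2 * d * ε) (affineMap ν (√ε • CFC.sqrt S) ((√n)⁻¹ • z))
        ∂stdGaussian (E d) := by
    intro ε hε ν
    obtain ⟨D', hD', hcov, hD'ν⟩ := exists_scaled_mem_gaussianFamily hS ν hε
    have h := hacc D' hD'
    rw [hAK, hcov] at h
    rw [← compProd_comap_empMean_apply (n := n) K hD'ν (hB _)]
    refine (ENNReal.ofReal_le_ofReal h).trans ?_
    rw [ofReal_measureReal]
    refine measure_mono fun p hp => ?_
    have hp' : (p.2 - empMean p.1).ofLp ⬝ᵥ (ε • S)⁻¹ *ᵥ (p.2 - empMean p.1).ofLp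
      ≤ 2 * ρ ^ 2 * d := hp
    have := invForm_smul_left ε S (p.2 - empMean p.1) (p.2 - empMean p.1)
    rw [invForm] at this
    rw [this, inv_mul_le_iff₀ hε] at hp'
    change Q (p.2 - empMean p.1) ≤ 2 * ρ ^ 2 * d * ε
    rw [mul_comm]
    exact hp'
  have hmix : ∀ ε : ℝ, 0 < ε → ε < 1 → ENNReal.ofReal 0.99 ≤
      ((Measure.pi fun _ : Fin n => (D : Measure (E d))) ⊗ₘ A.kernel D)
        {p | (empMean p.1, p.2) ∈ B (2 * ρ ^ 2 * d * ε)} := by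
    intro ε hε hε1
    rw [hAK, compProd_comap_empMean_apply (n := n) K hDμ (hB _)]
    have hcomb := (measurePreserving_sum_smul (d := d) ![√(1 - ε), √ε] (by
      simp [Fin.sum_univ_two, Real.mul_self_sqrt hε.le,
        Real.mul_self_sqrt (by linarith : 0 ≤ 1 - ε)])).lintegral_comp
        (f := fun z => φ (2 * ρ ^ 2 * d * ε) (affineMap μ (CFC.sqrt S) ((√n)⁻¹ • z)))
        ((hφ _).comp ((continuous_affineMap _ _).measurable.comp (measurable_const_smul _)))
    have hmprod : Measurable fun z : E d × E d => φ (2 * ρ ^ 2 * d * ε)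
        (affineMap μ (CFC.sqrt S) ((√n)⁻¹ • (√(1 - ε) • z.1 + √ε • z.2))) :=
      (hφ _).comp ((continuous_affineMap _ _).measurable.comp (by fun_prop))
    have hprod := (measurePreserving_finTwoArrow (stdGaussian (E d))).lintegral_comp hmprod
    have hswitch : ∫⁻ z, φ (2 * ρ ^ 2 * d * ε) (affineMap μ (CFC.sqrt S) ((√n)⁻¹ • z))
        ∂stdGaussian (E d) = ∫⁻ z : E d × E d, φ (2 * ρ ^ 2 * d * ε)
          (affineMap μ (CFC.sqrt S) ((√n)⁻¹ • (√(1 - ε) • z.1 + √ε • z.2)))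
          ∂(stdGaussian (E d)).prod (stdGaussian (E d)) := by
      rw [← hcomb, ← hprod]
      simp [stdFamily, Fin.sum_univ_two, MeasurableEquiv.finTwoArrow]
    change _ ≤ ∫⁻ z, φ (2 * ρ ^ 2 * d * ε) (affineMap μ (CFC.sqrt S) ((√n)⁻¹ • z))
        ∂stdGaussian (E d)
    rw [hswitch, lintegral_prod _ hmprod.aemeasurable]
    calc ENNReal.ofReal 0.99 = ∫⁻ _ : E d, ENNReal.ofReal 0.99 ∂stdGaussian (E d) := by simp
      _ ≤ _ := lintegral_mono fun g => ?_
    refine (hnarrow ε hε (affineMap μ (CFC.sqrt S) ((√n)⁻¹ • √(1 - ε) • g))).trans_eq ?_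
    refine lintegral_congr fun z => ?_
    congr 1
    simp only [affineMap, map_smul, map_add, smul_add, _root_.smul_apply, add_assoc]
  -- Let `ε` tend to `0`.
  have : IsMarkovKernel (A.kernel D) := A.markov D
  set M := (Measure.pi fun _ : Fin n => (D : Measure (E d))) ⊗ₘ A.kernel D
  have hm : Measurable fun p : (Fin n → E d) × E d => (empMean p.1, p.2) :=
    (measurable_empMean.comp measurable_fst).prodMk measurable_snd
  let G : ℕ → Set ((Fin n → E d) × E d) := fun k =>
    {p | (empMean p.1, p.2) ∈ B (2 * ρ ^ 2 * d * (1 / ((k : ℝ) + 2)))}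
  have hG : Antitone G := fun k l hkl p hp => by
    have hp' : Q (p.2 - empMean p.1) ≤ 2 * ρ ^ 2 * d * (1 / ((l : ℝ) + 2)) := hp
    change Q (p.2 - empMean p.1) ≤ 2 * ρ ^ 2 * d * (1 / ((k : ℝ) + 2))
    refine hp'.trans (mul_le_mul_of_nonneg_left ?_ (by positivity))
    have : (k : ℝ) ≤ l := by exact_mod_cast hkl
    gcongr
  have hlim := tendsto_measure_iInter_atTop (μ := M) (s := G)
    (fun k => (hm (hB _)).nullMeasurableSet) hG ⟨0, measure_ne_top _ _⟩
  have hge : ENNReal.ofReal 0.99 ≤ M (⋂ k, G k) :=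
    ge_of_tendsto' hlim fun k => hmix _ (by positivity) (by
      rw [div_lt_one (by positivity)]
      linarith [(Nat.cast_nonneg k : (0 : ℝ) ≤ k)])
  have hsub : (⋂ k, G k) ⊆ {p | p.2 = empMean p.1} := by
    intro p hp
    have h1 : ∀ k : ℕ, Q (p.2 - empMean p.1) ≤ 2 * ρ ^ 2 * d * (1 / ((k : ℝ) + 2)) :=
      fun k => Set.mem_iInter.1 hp k
    have h2 : Filter.Tendsto (fun k : ℕ => 2 * ρ ^ 2 * d * (1 / ((k : ℝ) + 2))) Filter.atTop
        (nhds (2 * ρ ^ 2 * d * 0)) := by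
      refine Filter.Tendsto.const_mul _ ?_
      have := (tendsto_one_div_add_atTop_nhds_zero_nat (𝕜 := ℝ)).comp (Filter.tendsto_add_atTop_nat 1)
      refine this.congr fun k => ?_
      simp only [Function.comp]
      push_cast
      ring
    have h3 : Q (p.2 - empMean p.1) ≤ 2 * ρ ^ 2 * d * 0 := ge_of_tendsto' h2 h1
    rw [mul_zero] at h3
    by_contra hne
    have hv : (p.2 - empMean p.1).ofLp ≠ 0 := by
      intro h
      exact hne (sub_eq_zero.1 (by ext i; exact congrFun h i))
    have := hS.inv.dotProduct_mulVec_pos hv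
    rw [star_trivial] at this
    exact absurd h3 (not_le.2 this)
  have h4 := ENNReal.toReal_mono (measure_ne_top M _) (hge.trans (measure_mono hsub))
  rwa [ENNReal.toReal_ofReal (by norm_num)] at h4

end

/-! ### The attack statistic -/

section

variable {d m : ℕ}

/-- A sum over the block of `k` indices starting at `s`. -/
theorem sum_block {M : Type*} [AddCommMonoid M] {s k : ℕ} (h : s + k ≤ m) (F : ℕ → M) :
    ∑ j : Fin m, (if s ≤ (j : ℕ) ∧ (j : ℕ) < s + k then F j else 0)
      = ∑ i ∈ Finset.range k, F (s + i) := by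
  rw [Fin.sum_univ_eq_sum_range (fun j => if s ≤ j ∧ j < s + k then F j else 0) m,
    ← Finset.sum_filter]
  have : (Finset.range m).filter (fun j => s ≤ j ∧ j < s + k) = Finset.Ico s (s + k) := by
    ext j
    simp only [Finset.mem_filter, Finset.mem_range, Finset.mem_Ico]
    omega
  rw [this, Finset.sum_Ico_eq_sum_range, Nat.add_sub_cancel_left]

theorem sample_of_lt (Y : Fin m → E d) {k : ℕ} (h : k < m) : sample Y k = Y ⟨k, h⟩ := by
  simp [sample, h]

theorem sample_fin (Y : Fin m → E d) (j : Fin m) : sample Y j = Y j := by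
  simp [sample]

theorem continuous_sample (k : ℕ) : Continuous fun Y : Fin m → E d => sample Y k := by
  unfold sample
  split_ifs <;> fun_prop

theorem continuous_blockMean (s k : ℕ) : Continuous fun Y : Fin m → E d => blockMean Y s k := by
  unfold blockMean
  suffices Continuous fun Y : Fin m → E d => ∑ i ∈ Finset.range k, sample Y (s + i) from
    this.fun_const_smul _
  exact continuous_finsetSum _ fun i _ => continuous_sample _

theorem continuous_empCov (k : ℕ) : Continuous fun Y : Fin m → E d => empCov Y k := by
  unfold empCov
  have h : ∀ i, Continuous fun Y : Fin m → E d => (sample Y i - blockMean Y 0 k).ofLp := fun i =>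
    (PiLp.continuous_ofLp 2 _).comp ((continuous_sample i).sub (continuous_blockMean 0 k))
  suffices Continuous fun Y : Fin m → E d => ∑ i ∈ Finset.range k,
      vecMulVec (sample Y i - blockMean Y 0 k).ofLp (sample Y i - blockMean Y 0 k).ofLp from
    this.fun_const_smul _
  exact continuous_finsetSum _ fun i _ => (h i).matrix_vecMulVec (h i)

theorem measurable_whitenedAttack (m₁ m₂ : ℕ) (t : ℝ) :
    Measurable fun p : (Fin m → E d) × E d × E d => whitenedAttack m₁ m₂ t p.1 p.2.1 p.2.2 := by
  have h : Measurable fun p : (Fin m → E d) × E d × E d => invForm (empCov p.1 m₁)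
      (p.2.1 - blockMean p.1 m₁ m₂) (p.2.2 - sample p.1 (m₁ + m₂)) :=
    measurable_invForm ((continuous_empCov m₁).comp continuous_fst)
      ((continuous_fst.comp continuous_snd).sub ((continuous_blockMean _ _).comp continuous_fst))
      ((continuous_snd.comp continuous_snd).sub ((continuous_sample _).comp continuous_fst))
  exact Measurable.ite (measurableSet_le measurable_const h) measurable_const measurable_const

theorem empCov_eq_sampleCov (Y : Fin m → E d) {k : ℕ} (h : k ≤ m) :
    empCov Y k = sampleCov fun j : Fin k => Y (Fin.castLE h j) := by
  have hY : ∀ j : Fin k, sample Y j = Y (Fin.castLE h j) := fun j =>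
    sample_of_lt Y (j.2.trans_le h)
  have hmean : blockMean Y 0 k = (k : ℝ)⁻¹ • ∑ j : Fin k, Y (Fin.castLE h j) := by
    simp [blockMean, Finset.sum_range, hY]
  rw [empCov, sampleCov, Fintype.card_fin, ← hmean, Finset.sum_range]
  simp [hY]

theorem affineMap_sub (μ : E d) (R : Matrix (Fin d) (Fin d) ℝ) (x y : E d) :
    affineMap μ R x - affineMap μ R y = toEuclideanCLM (𝕜 := ℝ) R (x - y) := by
  simp [affineMap]

theorem blockMean_affineMap (μ : E d) (R : Matrix (Fin d) (Fin d) ℝ) (Y : Fin m → E d) {s k : ℕ}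
    (hk : 0 < k) (h : s + k ≤ m) :
    blockMean (fun j => affineMap μ R (Y j)) s k = affineMap μ R (blockMean Y s k) := by
  have hk' : (k : ℝ) ≠ 0 := Nat.cast_ne_zero.2 hk.ne'
  have hY : ∀ i ∈ Finset.range k, sample (fun j => affineMap μ R (Y j)) (s + i)
      = μ + toEuclideanCLM (𝕜 := ℝ) R (sample Y (s + i)) := fun i hi => by
    have hi' : s + i < m := by have := Finset.mem_range.1 hi; omega
    rw [sample_of_lt _ hi', sample_of_lt _ hi', affineMap]
  rw [blockMean, Finset.sum_congr rfl hY, affineMap, blockMean, Finset.sum_add_distrib, smul_add,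
    Finset.sum_const, Finset.card_range, ← Nat.cast_smul_eq_nsmul ℝ, smul_smul,
    inv_mul_cancel₀ hk', one_smul, map_smul, map_sum]

theorem empCov_affineMap (μ : E d) {R : Matrix (Fin d) (Fin d) ℝ} (hR : Rᵀ = R) (Y : Fin m → E d)
    {k : ℕ} (hk : 0 < k) (h : k ≤ m) :
    empCov (fun j => affineMap μ R (Y j)) k = R * empCov Y k * R := by
  rw [empCov, empCov, blockMean_affineMap μ R Y hk (by omega), mul_smul_comm, smul_mul_assoc,
    Finset.mul_sum, Finset.sum_mul]
  congr 1
  refine Finset.sum_congr rfl fun i hi => ?_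
  have hi' : i < m := (Finset.mem_range.1 hi).trans_le h
  rw [sample_of_lt _ hi', sample_of_lt _ hi', affineMap_sub, ofLp_toEuclideanCLM, mul_vecMulVec,
    vecMulVec_mul, ← mulVec_transpose, hR]

theorem invForm_conj {R : Matrix (Fin d) (Fin d) ℝ} (hR : Rᵀ = R) (hdet : R.det ≠ 0)
    (B : Matrix (Fin d) (Fin d) ℝ) (u v : E d) :
    invForm (R * B * R) (toEuclideanCLM (𝕜 := ℝ) R u) (toEuclideanCLM (𝕜 := ℝ) R v)
      = invForm B u v := by
  have hu := isUnit_iff_ne_zero.2 hdet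
  rw [invForm, ofLp_toEuclideanCLM, ofLp_toEuclideanCLM, Matrix.mul_inv_rev, Matrix.mul_inv_rev,
    mulVec_mulVec, Matrix.mul_assoc, Matrix.mul_assoc, nonsing_inv_mul _ hu, Matrix.mul_one,
    ← mulVec_mulVec, dotProduct_comm, dotProduct_mulVec, ← mulVec_transpose, hR, mulVec_mulVec,
    mul_nonsing_inv _ hu, one_mulVec, dotProduct_comm, invForm]

/-- The attack statistic is invariant under affine changes of coordinates. -/
theorem whitenedAttack_affineMap (μ : E d) {R : Matrix (Fin d) (Fin d) ℝ} (hR : Rᵀ = R)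
    (hdet : R.det ≠ 0) {m₁ m₂ : ℕ} (h₁ : 0 < m₁) (h₂ : 0 < m₂) (h : m₁ + m₂ + 1 ≤ m) (t : ℝ)
    (Y : Fin m → E d) (w x : E d) :
    whitenedAttack m₁ m₂ t (fun j => affineMap μ R (Y j)) (affineMap μ R w) (affineMap μ R x)
      = whitenedAttack m₁ m₂ t Y w x := by
  have key : invForm (empCov (fun j => affineMap μ R (Y j)) m₁)
      (affineMap μ R w - blockMean (fun j => affineMap μ R (Y j)) m₁ m₂)
      (affineMap μ R x - sample (fun j => affineMap μ R (Y j)) (m₁ + m₂))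
      = invForm (empCov Y m₁) (w - blockMean Y m₁ m₂) (x - sample Y (m₁ + m₂)) := by
    rw [empCov_affineMap μ hR Y h₁ (by omega), blockMean_affineMap μ R Y h₂ (by omega),
      sample_of_lt _ (by omega : m₁ + m₂ < m), sample_of_lt _ (by omega : m₁ + m₂ < m),
      affineMap_sub, affineMap_sub, invForm_conj hR hdet]
  unfold invForm at key
  simp only [whitenedAttack, key]

theorem whitenedAttack_eq_IN_iff {m₁ m₂ : ℕ} {t : ℝ} {Y : Fin m → E d} {w x : E d} :
    whitenedAttack m₁ m₂ t Y w x = Verdict.IN ↔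
      t ≤ invForm (empCov Y m₁) (w - blockMean Y m₁ m₂) (x - sample Y (m₁ + m₂)) := by
  unfold whitenedAttack
  change (if t ≤ invForm _ _ _ then _ else _) = _ ↔ _
  split_ifs with h <;> simp [h]

theorem whitenedAttack_eq_OUT_iff {m₁ m₂ : ℕ} {t : ℝ} {Y : Fin m → E d} {w x : E d} :
    whitenedAttack m₁ m₂ t Y w x = Verdict.OUT ↔
      ¬ t ≤ invForm (empCov Y m₁) (w - blockMean Y m₁ m₂) (x - sample Y (m₁ + m₂)) := by
  unfold whitenedAttack
  change (if t ≤ invForm _ _ _ then _ else _) = _ ↔ _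
  split_ifs with h <;> simp [h]

end

section

/-- The index set of the Gaussian vectors of the game: the fresh point, the training points with the
noise vector, and the auxiliary samples. -/
abbrev GameIndex (n m : ℕ) : Type := Unit ⊕ (Fin n ⊕ Unit) ⊕ Fin m

variable {d n m : ℕ}

/-- The fresh point. -/
def fresh (g : GameIndex n m → E d) : E d := g (Sum.inl ())

/-- The training points. -/
def train (g : GameIndex n m → E d) (i : Fin n) : E d := g (Sum.inr (Sum.inl (Sum.inl i)))

/-- The noise vector. -/
def noise (g : GameIndex n m → E d) : E d := g (Sum.inr (Sum.inl (Sum.inr ())))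

/-- The auxiliary samples. -/
def aux (g : GameIndex n m → E d) (j : Fin m) : E d := g (Sum.inr (Sum.inr j))

/-- The coefficients of `empMean X + σ Z - blockMean Y m₁ m₂`. -/
noncomputable def shiftCoeff (n m m₁ m₂ : ℕ) (σ : ℝ) : GameIndex n m → ℝ :=
  Sum.elim 0 (Sum.elim (Sum.elim (fun _ => (n : ℝ)⁻¹) fun _ => σ)
    fun j => if m₁ ≤ (j : ℕ) ∧ (j : ℕ) < m₁ + m₂ then -(m₂ : ℝ)⁻¹ else 0)

theorem sum_shiftCoeff_smul {m₁ m₂ : ℕ} (h : m₁ + m₂ ≤ m) (σ : ℝ) (g : GameIndex n m → E d) :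
    ∑ i, shiftCoeff n m m₁ m₂ σ i • g i
      = empMean (train g) + σ • noise g - blockMean (aux g) m₁ m₂ := by
  have hb := sum_block h (fun j => (m₂ : ℝ)⁻¹ • sample (aux g) j)
  rw [← Finset.smul_sum] at hb
  rw [blockMean, ← hb, sub_eq_add_neg, ← Finset.sum_neg_distrib]
  simp only [shiftCoeff, Fintype.sum_sum_type, Sum.elim_inl, Sum.elim_inr, Pi.zero_apply, zero_smul,
    Finset.sum_const_zero, zero_add, ← Finset.smul_sum, Finset.univ_unique, Finset.sum_singleton]
  refine congrArg₂ _ rfl (Finset.sum_congr rfl fun j _ => ?_)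
  split_ifs
  · rw [sample_fin, neg_smul]; rfl
  · simp

theorem sum_shiftCoeff_sq [NeZero n] {m₁ m₂ : ℕ} (h₂ : 0 < m₂) (h : m₁ + m₂ ≤ m) (σ : ℝ) :
    ∑ i, shiftCoeff n m m₁ m₂ σ i ^ 2 = (n : ℝ)⁻¹ + σ ^ 2 + (m₂ : ℝ)⁻¹ := by
  have hn : (n : ℝ) ≠ 0 := Nat.cast_ne_zero.2 (NeZero.ne n)
  have hm : (m₂ : ℝ) ≠ 0 := Nat.cast_ne_zero.2 h₂.ne'
  have hb := sum_block h (fun _ => ((m₂ : ℝ)⁻¹) ^ 2)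
  simp only [shiftCoeff, Fintype.sum_sum_type, Sum.elim_inl, Sum.elim_inr, Pi.zero_apply, ite_pow,
    neg_sq, zero_pow two_ne_zero, hb]
  simp
  field_simp

/-- The fresh point has a small statistic. -/
theorem measureReal_out_le [NeZero n] {N m₂ : ℕ} (hd : 0 < d) (hN : 1000 * d ≤ N) (h₂ : 0 < m₂)
    (h : N + 1 + m₂ + 1 ≤ m) (σ : ℝ)
    (hs : 40 * √d * √((n : ℝ)⁻¹ + σ ^ 2 + (m₂ : ℝ)⁻¹) ≤ d / (3200 * n)) :
    (stdFamily (GameIndex n m) d).real {g | 1 / 800 * d / n ≤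
      invForm (empCov (aux g) (N + 1))
        (empMean (train g) + σ • noise g - blockMean (aux g) (N + 1) m₂)
        (fresh g - sample (aux g) (N + 1 + m₂))} ≤ 1 / 50 := by
  have hn : (0 : ℝ) < n := Nat.cast_pos.2 (Nat.pos_of_ne_zero (NeZero.ne n))
  have hm₂ : (0 : ℝ) < m₂ := Nat.cast_pos.2 h₂
  have hd' : (0 : ℝ) < d := Nat.cast_pos.2 hd
  set q : Fin m := ⟨N + 1 + m₂, by omega⟩ with hq
  set v : GameIndex n m → ℝ :=
    Sum.elim 1 (Sum.elim 0 fun j => if j = q then -1 else 0) with hv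
  set e : Fin (N + 1) → GameIndex n m := fun j => Sum.inr (Sum.inr (Fin.castLE (by omega) j)) with he
  have hα : 0 < (n : ℝ)⁻¹ + σ ^ 2 + (m₂ : ℝ)⁻¹ := by positivity
  have key := measureReal_sampleCov_cross_le (d := d) hd hN e
    (fun i j hij => by simpa [he, Fin.ext_iff] using hij)
    (u := shiftCoeff n m (N + 1) m₂ σ) (v := v)
    (fun j => by
      simp [he, shiftCoeff]; omega)
    (fun j => by
      simp [he, hv, hq, Fin.ext_iff]; omega)
    (Real.sqrt_pos.2 hα) (Real.sqrt_pos.2 (by norm_num : (0 : ℝ) < 2))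
    (by rw [Real.sq_sqrt hα.le, sum_shiftCoeff_sq h₂ (by omega)])
    (by
      rw [Real.sq_sqrt (by norm_num)]
      simp [hv, Fintype.sum_sum_type, ite_pow]
      norm_num)
    (by simp [hv, Fintype.sum_sum_type, shiftCoeff, hq])
  refine (measureReal_mono fun g hg => ?_).trans key
  have hg' : 1 / 800 * (d : ℝ) / n ≤ _ := hg
  have hvg : ∑ i, v i • g i = fresh g - sample (aux g) (N + 1 + m₂) := by
    rw [sample_of_lt _ (by omega : N + 1 + m₂ < m)]
    simp [hv, Fintype.sum_sum_type, ite_smul, fresh, aux, sub_eq_add_neg]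
    rfl
  rw [← hvg, ← sum_shiftCoeff_smul (by omega), empCov_eq_sampleCov _ (by omega)] at hg'
  change 40 * √d * (√((n : ℝ)⁻¹ + σ ^ 2 + (m₂ : ℝ)⁻¹) * √2) < |_|
  refine lt_of_lt_of_le ?_ (hg'.trans (le_abs_self _))
  have h2 : √2 ≤ 2 := Real.sqrt_le_iff.2 ⟨by norm_num, by norm_num⟩
  calc 40 * √d * (√((n : ℝ)⁻¹ + σ ^ 2 + (m₂ : ℝ)⁻¹) * √2)
      = (40 * √d * √((n : ℝ)⁻¹ + σ ^ 2 + (m₂ : ℝ)⁻¹)) * √2 := by ring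
    _ ≤ d / (3200 * n) * 2 := by gcongr
    _ < 1 / 800 * d / n := by
      rw [div_mul_eq_mul_div, div_lt_div_iff₀ (by positivity) hn]
      nlinarith [mul_pos hd' hn]

/-- A training point has a large statistic: it contains the term `Xᵢᵀ H Xᵢ / n`. -/
theorem exists_measureReal_in_le : ∃ d₀ : ℝ, 1 ≤ d₀ ∧ ∀ {d n m N m₂ : ℕ} [NeZero n], d₀ ≤ d →
    1000 * d ≤ N → 0 < m₂ → N + 1 + m₂ + 1 ≤ m → ∀ σ : ℝ,
    40 * √d * √((n : ℝ)⁻¹ + σ ^ 2 + (m₂ : ℝ)⁻¹) ≤ d / (3200 * n) →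
    (stdFamily (GameIndex n m) d).real {g | invForm (empCov (aux g) (N + 1))
        (empMean (train g) + σ • noise g - blockMean (aux g) (N + 1) m₂)
        (train g 0 - sample (aux g) (N + 1 + m₂)) < 1 / 800 * d / n} ≤ 7 / 100 := by
  obtain ⟨d₀, hd₀, H⟩ := exists_measureReal_sampleCov_diag_le
  refine ⟨d₀, hd₀, fun {d n m N m₂} _ hd hN h₂ h σ hs => ?_⟩
  have hn : (0 : ℝ) < n := Nat.cast_pos.2 (Nat.pos_of_ne_zero (NeZero.ne n))
  have hm₂ : (0 : ℝ) < m₂ := Nat.cast_pos.2 h₂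
  have hd' : (0 : ℝ) < d := by linarith
  have hd1 : 0 < d := by exact_mod_cast hd'
  set q : Fin m := ⟨N + 1 + m₂, by omega⟩ with hq
  set p : GameIndex n m := Sum.inr (Sum.inl (Sum.inl 0)) with hp
  set e : Fin (N + 1) → GameIndex n m := fun j => Sum.inr (Sum.inr (Fin.castLE (by omega) j)) with he
  have hinj : Function.Injective e := fun i j hij => by simpa [he, Fin.ext_iff] using hij
  have hep : ∀ j, e j ≠ p := fun j => by simp [he, hp]
  set u := shiftCoeff n m (N + 1) m₂ σ with hu
  -- The mean shift is `X₁ / n + r`, where `u'` holds the coefficients of `r`, so that the statistic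
  -- is `X₁ᵀ H X₁ / n + rᵀ H X₁ - (X₁ / n + r)ᵀ H Y₀`.
  set u' : GameIndex n m → ℝ := fun i => if i = p then 0 else u i with hu'
  set vx : GameIndex n m → ℝ := fun i => if i = p then 1 else 0 with hvx
  set vy : GameIndex n m → ℝ := fun i => if i = Sum.inr (Sum.inr q) then 1 else 0 with hvy
  have hue : ∀ j, u (e j) = 0 := fun j => by
    simp [hu, he, shiftCoeff]; omega
  have hup : u p = (n : ℝ)⁻¹ := rfl
  have huq : u (Sum.inr (Sum.inr q)) = 0 := by
    simp [hu, shiftCoeff, hq]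
  have hα : 0 < (n : ℝ)⁻¹ + σ ^ 2 + (m₂ : ℝ)⁻¹ := by positivity
  have husq : ∑ i, u i ^ 2 = (n : ℝ)⁻¹ + σ ^ 2 + (m₂ : ℝ)⁻¹ := sum_shiftCoeff_sq h₂ (by omega) σ
  have hu'sq : ∑ i, u' i ^ 2 = (n : ℝ)⁻¹ + σ ^ 2 + (m₂ : ℝ)⁻¹ - ((n : ℝ)⁻¹) ^ 2 := by
    rw [← husq, eq_sub_iff_add_eq, ← Finset.sum_erase_add _ (fun i => u' i ^ 2) (Finset.mem_univ p),
      ← Finset.sum_erase_add _ (fun i => u i ^ 2) (Finset.mem_univ p), hup]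
    have h0 : u' p = 0 := by simp [hu']
    rw [h0, zero_pow two_ne_zero, add_zero]
    congr 1
    refine Finset.sum_congr rfl fun i hi => ?_
    rw [hu']
    simp only [if_neg (Finset.ne_of_mem_erase hi)]
  have hn1 : (n : ℝ)⁻¹ ≤ 1 := inv_le_one_of_one_le₀ (by
    exact_mod_cast Nat.one_le_iff_ne_zero.2 (NeZero.ne n))
  have hn2 : ((n : ℝ)⁻¹) ^ 2 ≤ (n : ℝ)⁻¹ := by
    have : 0 < (n : ℝ)⁻¹ := by positivity
    nlinarith
  have hα' : 0 < (n : ℝ)⁻¹ + σ ^ 2 + (m₂ : ℝ)⁻¹ - ((n : ℝ)⁻¹) ^ 2 := by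
    have : 0 < (m₂ : ℝ)⁻¹ := by positivity
    nlinarith [sq_nonneg σ]
  have key1 := measureReal_sampleCov_cross_le (d := d) hd1 hN e hinj (u := u') (v := vx)
    (fun j => by simp [hu', hue]) (fun j => by simp [hvx, hep])
    (Real.sqrt_pos.2 hα') one_pos (by rw [Real.sq_sqrt hα'.le, hu'sq])
    (by simp [hvx, ite_pow]) (by simp [hvx, hu'])
  have key2 := measureReal_sampleCov_cross_le (d := d) hd1 hN e hinj (u := u) (v := vy)
    hue (fun j => by simp [hvy, he, hq, Fin.ext_iff]; omega)
    (Real.sqrt_pos.2 hα) one_pos (by rw [Real.sq_sqrt hα.le, husq])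
    (by simp [hvy, ite_pow]) (by simp [hvy, huq])
  have key3 := H d N hd (by omega) e hinj p hep
  set A1 : Set (GameIndex n m → E d) :=
    {g | 40 * √d * (√((n : ℝ)⁻¹ + σ ^ 2 + (m₂ : ℝ)⁻¹ - ((n : ℝ)⁻¹) ^ 2) * 1) <
      |invForm (sampleCov fun j => g (e j)) (∑ i, u' i • g i) (∑ i, vx i • g i)|}
  set A2 : Set (GameIndex n m → E d) := {g | 40 * √d * (√((n : ℝ)⁻¹ + σ ^ 2 + (m₂ : ℝ)⁻¹) * 1) <
    |invForm (sampleCov fun j => g (e j)) (∑ i, u i • g i) (∑ i, vy i • g i)|}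
  set A3 : Set (GameIndex n m → E d) :=
    {g | invForm (sampleCov fun j => g (e j)) (g p) (g p) < d / 400}
  refine (measureReal_mono (s₂ := A1 ∪ A2 ∪ A3) fun g hg => ?_).trans ?_
  · by_contra hgood
    have hg1 : ¬ 40 * √d * (√((n : ℝ)⁻¹ + σ ^ 2 + (m₂ : ℝ)⁻¹ - ((n : ℝ)⁻¹) ^ 2) * 1) <
      |invForm (sampleCov fun j => g (e j)) (∑ i, u' i • g i) (∑ i, vx i • g i)| :=
      fun h => hgood (Or.inl (Or.inl h))
    have hg2 : ¬ 40 * √d * (√((n : ℝ)⁻¹ + σ ^ 2 + (m₂ : ℝ)⁻¹) * 1) <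
      |invForm (sampleCov fun j => g (e j)) (∑ i, u i • g i) (∑ i, vy i • g i)| :=
      fun h => hgood (Or.inl (Or.inr h))
    have hg3 : ¬ invForm (sampleCov fun j => g (e j)) (g p) (g p) < d / 400 :=
      fun h => hgood (Or.inr h)
    push Not at hg1 hg2 hg3
    have hvxg : ∑ i, vx i • g i = g p := by simp [hvx, ite_smul]
    have hvyg : ∑ i, vy i • g i = sample (aux g) (N + 1 + m₂) := by
      rw [sample_of_lt _ (by omega : N + 1 + m₂ < m)]
      simp [hvy, ite_smul, aux, hq]
    have hug : ∑ i, u i • g i = (n : ℝ)⁻¹ • g p + ∑ i, u' i • g i := by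
      rw [← Finset.sum_erase_add _ (fun i => u i • g i) (Finset.mem_univ p),
        ← Finset.sum_erase_add _ (fun i => u' i • g i) (Finset.mem_univ p), hup, add_comm]
      have h0 : u' p = 0 := by simp [hu']
      rw [h0, zero_smul, add_zero]
      congr 1
      refine Finset.sum_congr rfl fun i hi => ?_
      rw [hu']
      simp only [if_neg (Finset.ne_of_mem_erase hi)]
    have hg' : invForm (empCov (aux g) (N + 1))
        (empMean (train g) + σ • noise g - blockMean (aux g) (N + 1) m₂)
        (g p - sample (aux g) (N + 1 + m₂)) < 1 / 800 * d / n := hg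
    rw [← sum_shiftCoeff_smul (by omega), empCov_eq_sampleCov _ (by omega), ← hu, ← hvyg,
      invForm_sub_right] at hg'
    change invForm (sampleCov fun j => g (e j)) (∑ i, u i • g i) (g p) -
      invForm (sampleCov fun j => g (e j)) (∑ i, u i • g i) (∑ i, vy i • g i) < _ at hg'
    have hdiag : invForm (sampleCov fun j => g (e j)) (∑ i, u i • g i) (g p)
        = (n : ℝ)⁻¹ * invForm (sampleCov fun j => g (e j)) (g p) (g p)
          + invForm (sampleCov fun j => g (e j)) (∑ i, u' i • g i) (g p) := by
      rw [hug, invForm_add_left]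
      congr 1
      have := invForm_smul_smul (sampleCov fun j => g (e j)) (n : ℝ)⁻¹ 1 (g p) (g p)
      rwa [one_smul, mul_one] at this
    rw [hvxg] at hg1
    rw [hdiag] at hg'
    have hs' : 40 * √d * (√((n : ℝ)⁻¹ + σ ^ 2 + (m₂ : ℝ)⁻¹ - ((n : ℝ)⁻¹) ^ 2) * 1)
        ≤ d / (3200 * n) := by
      refine le_trans ?_ hs
      rw [mul_one]
      gcongr
      linarith [sq_nonneg (n : ℝ)⁻¹]
    rw [mul_one] at hg2
    have i1 := (abs_le.1 (hg1.trans hs')).1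
    have i2 := (abs_le.1 (hg2.trans hs)).2
    have i3 : (n : ℝ)⁻¹ * (d / 400)
        ≤ (n : ℝ)⁻¹ * invForm (sampleCov fun j => g (e j)) (g p) (g p) := by gcongr
    have e1 : (d : ℝ) / (3200 * n) = (n : ℝ)⁻¹ * d / 3200 := by field_simp
    have e2 : 1 / 800 * (d : ℝ) / n = (n : ℝ)⁻¹ * d / 800 := by field_simp
    have e3 : 0 < (n : ℝ)⁻¹ * d := by positivity
    rw [e1] at i1 i2
    rw [e2] at hg'
    nlinarith
  · refine (measureReal_union_le _ _).trans ?_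
    have := measureReal_union_le (μ := stdFamily (GameIndex n m) d) A1 A2
    linarith

end

/-! ### The game as an image of independent Gaussian vectors -/

section

variable {d n m : ℕ}

theorem measurePreserving_splitSum (ι ι' : Type) [Fintype ι] [Fintype ι'] :
    MeasurePreserving (fun g : ι ⊕ ι' → E d => ((fun i => g (Sum.inl i)), fun i => g (Sum.inr i)))
      (stdFamily (ι ⊕ ι') d) ((stdFamily ι d).prod (stdFamily ι' d)) :=
  measurePreserving_sumPiEquivProdPi _

/-- The Gaussian vectors of the game, sorted as in `gameLaw`. -/
theorem measurePreserving_game :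
    MeasurePreserving (fun g : GameIndex n m → E d => (fresh g, (train g, noise g), aux g))
      (stdFamily (GameIndex n m) d)
      ((stdGaussian (E d)).prod
        (((stdFamily (Fin n) d).prod (stdGaussian (E d))).prod (stdFamily (Fin m) d))) := by
  have hu : MeasurePreserving (fun g : Unit → E d => g ()) (stdFamily Unit d) (stdGaussian (E d)) :=
    measurePreserving_eval (fun _ : Unit => stdGaussian (E d)) ()
  have h1 := ((MeasurePreserving.id (stdFamily (Fin n) d)).prod hu).comp
    (measurePreserving_splitSum (d := d) (Fin n) Unit)
  have h2 := (h1.prod (MeasurePreserving.id (stdFamily (Fin m) d))).comp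
    (measurePreserving_splitSum (d := d) (Fin n ⊕ Unit) (Fin m))
  exact (hu.prod h2).comp (measurePreserving_splitSum (d := d) Unit ((Fin n ⊕ Unit) ⊕ Fin m))

theorem measurePreserving_noisyEmpMean (ρ : ℝ) (D : ProbabilityMeasure (E d)) :
    MeasurePreserving (fun p : (Fin n → E d) × E d => (p.1, empMean p.1 + ρ • p.2))
      ((Measure.pi fun _ : Fin n => (D : Measure (E d))).prod (multivariateGaussian 0 (covMatrix D)))
      ((Measure.pi fun _ : Fin n => (D : Measure (E d))) ⊗ₘ (noisyEmpMean d n ρ).kernel D) := by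
  have hf : Measurable fun p : (Fin n → E d) × E d => empMean p.1 + ρ • p.2 :=
    (measurable_empMean.comp measurable_fst).add (measurable_snd.const_smul ρ)
  have hm : Measurable fun p : (Fin n → E d) × E d => (p.1, empMean p.1 + ρ • p.2) :=
    measurable_fst.prodMk hf
  refine ⟨hm, ?_⟩
  have := (noisyEmpMean d n ρ).markov D
  ext B hB
  rw [Measure.map_apply hm hB, Measure.compProd_apply hB, Measure.prod_apply (hm hB)]
  refine lintegral_congr fun x => ?_
  have hx : (noisyEmpMean d n ρ).kernel D x
      = (multivariateGaussian 0 (covMatrix D)).map fun z => empMean x + ρ • z := by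
    change ((Kernel.id ×ₖ Kernel.const (Fin n → E d)
      (multivariateGaussian 0 (covMatrix D))).map _) x = _
    rw [Kernel.map_apply _ hf, Kernel.prod_apply, Kernel.id_apply, Kernel.const_apply,
      Measure.dirac_prod, Measure.map_map hf measurable_prodMk_left]
    rfl
  have hz : Measurable fun z : E d => empMean x + ρ • z :=
    measurable_const.add (measurable_const_smul ρ)
  rw [hx, Measure.map_apply hz (measurable_prodMk_left hB)]
  rfl

/-- The game against the noisy empirical mean as an affine image of the Gaussian vectors. -/
theorem measurePreserving_gameLaw_noisyEmpMean {ρ : ℝ} {D : ProbabilityMeasure (E d)} {μ : E d}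
    {R : Matrix (Fin d) (Fin d) ℝ}
    (hD : (D : Measure (E d)) = (stdGaussian (E d)).map (affineMap μ R))
    (hZ : multivariateGaussian 0 (covMatrix D) = (stdGaussian (E d)).map (affineMap 0 R)) :
    MeasurePreserving (fun g : GameIndex n m → E d =>
        (affineMap μ R (fresh g),
          ((fun i => affineMap μ R (train g i)),
            empMean (fun i => affineMap μ R (train g i)) + ρ • affineMap 0 R (noise g)),
          fun j => affineMap μ R (aux g j)))
      (stdFamily (GameIndex n m) d) (gameLaw m (noisyEmpMean d n ρ) D) := by
  have hμ : MeasurePreserving (affineMap μ R) (stdGaussian (E d)) (D : Measure (E d)) :=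
    ⟨(continuous_affineMap _ _).measurable, hD.symm⟩
  have h0 : MeasurePreserving (affineMap 0 R) (stdGaussian (E d))
      (multivariateGaussian 0 (covMatrix D)) :=
    ⟨(continuous_affineMap _ _).measurable, hZ.symm⟩
  have := (noisyEmpMean d n ρ).markov D
  have h1 := (measurePreserving_noisyEmpMean (n := n) ρ D).comp
    ((measurePreserving_affineMap_pi hD (Fin n)).prod h0)
  have h2 := hμ.prod (h1.prod (measurePreserving_affineMap_pi hD (Fin m)))
  have h3 := h2.comp measurePreserving_game
  exact h3

/-- The points of the game, without the estimate. -/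
theorem measurePreserving_gameLaw_points (A : MeanEstimator d n) (D : ProbabilityMeasure (E d)) :
    MeasurePreserving (fun ω : E d × ((Fin n → E d) × E d) × (Fin m → E d) =>
        (ω.1, ω.2.1.1, ω.2.2))
      (gameLaw m A D) ((D : Measure (E d)).prod
        ((Measure.pi fun _ : Fin n => (D : Measure (E d))).prod
          (Measure.pi fun _ : Fin m => (D : Measure (E d))))) := by
  have := A.markov D
  have h1 : MeasurePreserving Prod.fst
      ((Measure.pi fun _ : Fin n => (D : Measure (E d))) ⊗ₘ A.kernel D)
      (Measure.pi fun _ : Fin n => (D : Measure (E d))) :=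
    ⟨measurable_fst, Measure.fst_compProd _ _⟩
  exact (MeasurePreserving.id _).prod (h1.prod (MeasurePreserving.id _))

theorem measurePreserving_points {D : ProbabilityMeasure (E d)} {μ : E d}
    {R : Matrix (Fin d) (Fin d) ℝ}
    (hD : (D : Measure (E d)) = (stdGaussian (E d)).map (affineMap μ R)) :
    MeasurePreserving (fun g : GameIndex n m → E d =>
        (affineMap μ R (fresh g), (fun i => affineMap μ R (train g i)),
          fun j => affineMap μ R (aux g j)))
      (stdFamily (GameIndex n m) d) ((D : Measure (E d)).prod
        ((Measure.pi fun _ : Fin n => (D : Measure (E d))).prod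
          (Measure.pi fun _ : Fin m => (D : Measure (E d))))) := by
  have hμ : MeasurePreserving (affineMap μ R) (stdGaussian (E d)) (D : Measure (E d)) :=
    ⟨(continuous_affineMap _ _).measurable, hD.symm⟩
  have h1 : MeasurePreserving Prod.fst ((stdFamily (Fin n) d).prod (stdGaussian (E d)))
      (stdFamily (Fin n) d) := measurePreserving_fst
  have h2 := hμ.prod (((measurePreserving_affineMap_pi hD (Fin n)).comp h1).prod
    (measurePreserving_affineMap_pi hD (Fin m)))
  have h3 := h2.comp measurePreserving_game
  exact h3

theorem measurePreserving_gameLaw_estimate (A : MeanEstimator d n) (D : ProbabilityMeasure (E d)) :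
    MeasurePreserving (fun ω : E d × ((Fin n → E d) × E d) × (Fin m → E d) => ω.2.1)
      (gameLaw m A D) ((Measure.pi fun _ : Fin n => (D : Measure (E d))) ⊗ₘ A.kernel D) := by
  have := A.markov D
  exact measurePreserving_fst.comp measurePreserving_snd

instance (A : MeanEstimator d n) (D : ProbabilityMeasure (E d)) :
    IsProbabilityMeasure (gameLaw m A D) := by
  have := A.markov D
  unfold gameLaw
  infer_instance

theorem le_measureReal_inter {X : Type*} [MeasurableSpace X] {μ : Measure X}
    [IsProbabilityMeasure μ] {s t u : Set X} (ht : MeasurableSet t) (hst : s ∩ t ⊆ u) {a b : ℝ}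
    (ha : a ≤ μ.real s) (hb : b ≤ μ.real t) : a + b - 1 ≤ μ.real u := by
  have h1 := measureReal_inter_add_sdiff (μ := μ) (s := s) ht
  have h2 : μ.real (s \ t) ≤ μ.real tᶜ := measureReal_mono fun x hx => hx.2
  have h3 := probReal_compl_eq_one_sub (μ := μ) ht
  have h4 := measureReal_mono (μ := μ) hst
  linarith

/-- If a test on the exact empirical mean succeeds with probability `a`, it succeeds with
probability at least `a - 0.01` on any estimator of the class `symmetricClass`. -/
theorem le_measureReal_of_symmetricClass [NeZero n] {ρ : ℝ} {A : MeanEstimator d n}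
    (hA : A ∈ symmetricClass n d ρ) {D : ProbabilityMeasure (E d)} (hD : D ∈ gaussianFamily d)
    {μ : E d} {R : Matrix (Fin d) (Fin d) ℝ}
    (hDμ : (D : Measure (E d)) = (stdGaussian (E d)).map (affineMap μ R))
    {T : Set (E d × ((Fin n → E d) × E d) × (Fin m → E d))} (hT : MeasurableSet T) {a : ℝ}
    (ha : a ≤ (stdFamily (GameIndex n m) d).real {g | (affineMap μ R (fresh g),
      ((fun i => affineMap μ R (train g i)), affineMap μ R (empMean (train g))),
      fun j => affineMap μ R (aux g j)) ∈ T}) :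
    a - 0.01 ≤ (gameLaw m A D).real T := by
  have hm : Measurable fun p : E d × (Fin n → E d) × (Fin m → E d) =>
      (p.1, (p.2.1, empMean p.2.1), p.2.2) := by
    have := measurable_empMean (d := d) (n := n)
    fun_prop
  have h1 := (measurePreserving_points (n := n) (m := m) hDμ).measureReal_preimage
    (hm hT).nullMeasurableSet
  have h2 := (measurePreserving_gameLaw_points (m := m) A D).measureReal_preimage
    (hm hT).nullMeasurableSet
  have hE : MeasurableSet {p : (Fin n → E d) × E d | p.2 = empMean p.1} :=
    measurableSet_eq_fun measurable_snd (measurable_empMean.comp measurable_fst)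
  have h3 := (measurePreserving_gameLaw_estimate (m := m) A D).measureReal_preimage
    hE.nullMeasurableSet
  have h4 := le_measureReal_eq_empMean hA hD
  rw [← h3] at h4
  have h5 : a ≤ (gameLaw m A D).real ((fun ω => (ω.1, ω.2.1.1, ω.2.2)) ⁻¹'
      ((fun p : E d × (Fin n → E d) × (Fin m → E d) =>
        (p.1, (p.2.1, empMean p.2.1), p.2.2)) ⁻¹' T)) := by
    rw [h2, ← h1]
    refine ha.trans_eq (congrArg _ ?_)
    ext g
    change _ ∈ T ↔ _ ∈ T
    simp only [empMean_affineMap]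
  have h6 := le_measureReal_inter ((measurePreserving_gameLaw_estimate (m := m) A D).measurable hE)
    (u := T) (fun ω hω => by
      obtain ⟨ω0, ⟨x, z⟩, y⟩ := ω
      obtain ⟨h7, h8⟩ := hω
      have h8' : z = empMean x := h8
      have h7' : (ω0, (x, empMean x), y) ∈ T := h7
      rwa [← h8'] at h7') h5 h4
  linarith

end

/-! ### Success of the attack -/

section

/-- Both halves of the game in terms of the Gaussian vectors, for an estimator that adds noise of
level `σ` to the empirical mean. -/
theorem exists_le_measureReal_whitenedAttack : ∃ d₀ : ℝ, 1 ≤ d₀ ∧ ∀ {d n m N m₂ : ℕ} [NeZero n],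
    d₀ ≤ d → 1000 * d ≤ N → 0 < m₂ → N + 1 + m₂ + 1 ≤ m → ∀ σ : ℝ,
    40 * √d * √((n : ℝ)⁻¹ + σ ^ 2 + (m₂ : ℝ)⁻¹) ≤ d / (3200 * n) →
    ∀ (μ : E d) {R : Matrix (Fin d) (Fin d) ℝ}, Rᵀ = R → R.det ≠ 0 →
    0.98 ≤ (stdFamily (GameIndex n m) d).real {g |
      whitenedAttack (N + 1) m₂ (1 / 800 * d / n) (fun j => affineMap μ R (aux g j))
        (affineMap μ R (empMean (train g) + σ • noise g)) (affineMap μ R (fresh g))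
        = Verdict.OUT} ∧
    0.93 ≤ (stdFamily (GameIndex n m) d).real {g |
      whitenedAttack (N + 1) m₂ (1 / 800 * d / n) (fun j => affineMap μ R (aux g j))
        (affineMap μ R (empMean (train g) + σ • noise g)) (affineMap μ R (train g 0))
        = Verdict.IN} := by
  obtain ⟨d₀, hd₀, H⟩ := exists_measureReal_in_le
  refine ⟨d₀, hd₀, fun {d n m N m₂} _ hd hN h₂ h σ hs μ R hR hdet => ?_⟩
  have hd1 : 0 < d := by
    have : (0 : ℝ) < d := by linarith
    exact_mod_cast this
  have hmean : Measurable fun g : GameIndex n m → E d => empMean (train g) + σ • noise g := by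
    have h1 : Measurable (train : (GameIndex n m → E d) → Fin n → E d) := by
      unfold train; fun_prop
    have h2 : Measurable (noise : (GameIndex n m → E d) → E d) := by
      unfold noise; fun_prop
    exact (measurable_empMean.comp h1).add (h2.const_smul σ)
  have haux : Measurable (aux : (GameIndex n m → E d) → Fin m → E d) := by
    unfold aux; fun_prop
  have hmeas : ∀ x : (GameIndex n m → E d) → E d, Measurable x → ∀ v : Verdict,
      MeasurableSet {g : GameIndex n m → E d | whitenedAttack (N + 1) m₂ (1 / 800 * d / n) (aux g)
        (empMean (train g) + σ • noise g) (x g) = v} := fun x hx v =>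
    ((measurable_whitenedAttack (N + 1) m₂ (1 / 800 * d / n)).comp
      (haux.prodMk (hmean.prodMk hx))) (t := {v}) trivial
  simp only [whitenedAttack_affineMap μ hR hdet (Nat.succ_pos N) h₂ h]
  have hcompl : ∀ {s : Set (GameIndex n m → E d)} {a : ℝ}, MeasurableSet s →
      (stdFamily (GameIndex n m) d).real sᶜ ≤ a → 1 - a ≤ (stdFamily (GameIndex n m) d).real s :=
    fun {s a} hs ha => by
      rw [probReal_compl_eq_one_sub hs] at ha
      linarith
  constructor
  · have := hcompl (hmeas fresh (by unfold fresh; fun_prop) Verdict.OUT) (a := 1 / 50) (by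
      refine (measureReal_mono fun g hg => ?_).trans (measureReal_out_le (n := n) hd1 hN h₂ h σ hs)
      have hg' : ¬ whitenedAttack _ _ _ _ _ _ = Verdict.OUT := hg
      rw [whitenedAttack_eq_OUT_iff, not_not] at hg'
      exact hg')
    norm_num at this ⊢
    exact this
  · have := hcompl (hmeas (fun g => train g 0) (by unfold train; fun_prop) Verdict.IN)
      (a := 7 / 100) (by
      refine (measureReal_mono fun g hg => ?_).trans (H (n := n) (m := m) hd hN h₂ h σ hs)
      have hg' : ¬ whitenedAttack _ _ _ _ _ _ = Verdict.IN := hg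
      rw [whitenedAttack_eq_IN_iff, not_le] at hg'
      exact hg')
    norm_num at this ⊢
    exact this

/-- In the regime of the theorem, the error `μhat - blockMean` is too short, by a factor of order
`√c`, for its products with independent vectors to compete with the signal `d / n`. -/
theorem noise_le_signal {d n m₂ : ℝ} {ρ σ : ℝ} (hn : 0 < n) (hρ : 0 < ρ) (hσ : 0 ≤ σ) (hσρ : σ ≤ ρ)
    (hm₂ : min n (1 / ρ ^ 2) ≤ m₂) (hd : 3200 ^ 3 * (n + n ^ 2 * ρ ^ 2) ≤ d) :
    40 * √d * √(n⁻¹ + σ ^ 2 + m₂⁻¹) ≤ d / (3200 * n) := by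
  have hd0 : 0 < d := lt_of_lt_of_le (by positivity) hd
  have h1 : m₂⁻¹ ≤ n⁻¹ + ρ ^ 2 := by
    have hmin : 0 < min n (1 / ρ ^ 2) := lt_min hn (by positivity)
    have h2 : m₂⁻¹ ≤ (min n (1 / ρ ^ 2))⁻¹ := inv_anti₀ hmin hm₂
    refine h2.trans ?_
    rcases min_choice n (1 / ρ ^ 2) with h | h
    · rw [h]; linarith [sq_nonneg ρ]
    · rw [h, one_div, inv_inv]; linarith [inv_pos.2 hn]
  have h2 : σ ^ 2 ≤ ρ ^ 2 := by gcongr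
  have h3 : n⁻¹ + σ ^ 2 + m₂⁻¹ ≤ d / (128000 * n) ^ 2 := by
    have h4 : 2 * (n⁻¹ + ρ ^ 2) = 2 * (n + n ^ 2 * ρ ^ 2) / n ^ 2 := by
      field_simp
    have h5 : 2 * (n + n ^ 2 * ρ ^ 2) / n ^ 2 ≤ d / (128000 * n) ^ 2 := by
      rw [div_le_div_iff₀ (by positivity) (by positivity)]
      have : 0 ≤ n ^ 2 := by positivity
      nlinarith
    linarith
  rw [mul_assoc, ← Real.sqrt_mul hd0.le]
  have h6 : √(d * (n⁻¹ + σ ^ 2 + m₂⁻¹)) ≤ d / (128000 * n) := by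
    rw [Real.sqrt_le_iff]
    refine ⟨by positivity, ?_⟩
    calc d * (n⁻¹ + σ ^ 2 + m₂⁻¹) ≤ d * (d / (128000 * n) ^ 2) := by gcongr
      _ = (d / (128000 * n)) ^ 2 := by field_simp
  calc 40 * √(d * (n⁻¹ + σ ^ 2 + m₂⁻¹)) ≤ 40 * (d / (128000 * n)) := by gcongr
    _ = d / (3200 * n) := by field_simp; norm_num

end

end MIA

theorem mainTheorem2 :
    ∃ c : ℝ, 1 < c ∧ ∃ C : ℝ, 0 < C ∧ ∃ κ : ℝ, 0 < κ ∧
      ∀ (d n m : ℕ) [NeZero n] (ρ : ℝ), 0 < ρ → ρ < 1 →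
        c * (d : ℝ) ≤ (m : ℝ) →
        c * ((n : ℝ) + (n : ℝ) ^ 2 * ρ ^ 2) ≤ (d : ℝ) →
        ⌈C * (d : ℝ)⌉₊ + ⌈C * min (n : ℝ) (1 / ρ ^ 2)⌉₊ + 1 ≤ m ∧
        MIA.IsSampleBasedMIA (m := m) (MIA.gaussianFamily d)
          (MIA.symmetricClass n d ρ ∪ {MIA.noisyEmpMean d n ρ})
          (MIA.whitenedAttack ⌈C * (d : ℝ)⌉₊ ⌈C * min (n : ℝ) (1 / ρ ^ 2)⌉₊
            (κ * (d : ℝ) / (n : ℝ))) := by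
  obtain ⟨d₀, hd₀, H⟩ := MIA.exists_le_measureReal_whitenedAttack
  -- `C = 1001` makes the covariance sample large enough for the bounds on `H`; `c` is large enough
  -- for the signal `d / (400 n)` to dominate the cross terms and for `d ≥ d₀`, the dimension from
  -- which `‖X₁‖²` concentrates.
  refine ⟨3200 ^ 3 + d₀, by linarith, 1001, by norm_num, 1 / 800, by norm_num, ?_⟩
  intro d n m _ ρ hρ _ hm hd
  have hn1 : (1 : ℝ) ≤ n := by exact_mod_cast Nat.one_le_iff_ne_zero.2 (NeZero.ne n)
  have hn : (0 : ℝ) < n := by linarith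
  have hq : 0 ≤ (n : ℝ) ^ 2 * ρ ^ 2 := by positivity
  have hdn : 3200 ^ 3 * ((n : ℝ) + n ^ 2 * ρ ^ 2) ≤ d := by nlinarith
  have hdd₀ : d₀ ≤ d := by nlinarith
  have hnd : 3200 ^ 3 * (n : ℝ) ≤ d := by linarith
  have hd1 : (3 : ℝ) ≤ d := by linarith
  have hmd : 3200 ^ 3 * (d : ℝ) ≤ m := by nlinarith
  have hmin : 0 < min (n : ℝ) (1 / ρ ^ 2) := lt_min hn (by positivity)
  set m₂ := ⌈1001 * min (n : ℝ) (1 / ρ ^ 2)⌉₊ with hm₂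
  have hm₂l : 1001 * min (n : ℝ) (1 / ρ ^ 2) ≤ m₂ := Nat.le_ceil _
  have hm₂u : (m₂ : ℝ) < 1001 * min (n : ℝ) (1 / ρ ^ 2) + 1 := Nat.ceil_lt_add_one (by positivity)
  have hm₂0 : 0 < m₂ := Nat.ceil_pos.2 (by positivity)
  have hminn := min_le_left (n : ℝ) (1 / ρ ^ 2)
  obtain ⟨N, hN⟩ : ∃ N, ⌈1001 * (d : ℝ)⌉₊ = N + 1 :=
    Nat.exists_eq_succ_of_ne_zero (Nat.ceil_pos.2 (by linarith)).ne'
  have hNl : 1001 * (d : ℝ) ≤ N + 1 := by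
    have := Nat.le_ceil (1001 * (d : ℝ))
    rw [hN] at this
    exact_mod_cast this
  have hNu : ((N : ℝ) + 1) < 1001 * d + 1 := by
    have := Nat.ceil_lt_add_one (a := 1001 * (d : ℝ)) (by linarith)
    rw [hN] at this
    exact_mod_cast this
  have hNd : 1000 * d ≤ N := by
    have : 1000 * (d : ℝ) ≤ N := by linarith
    exact_mod_cast this
  have hsum : N + 1 + m₂ + 1 ≤ m := by
    have : (N : ℝ) + 1 + m₂ + 1 ≤ m := by linarith
    exact_mod_cast this
  rw [hN]
  have hsig : ∀ σ : ℝ, 0 ≤ σ → σ ≤ ρ →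
      40 * √(d : ℝ) * √((n : ℝ)⁻¹ + σ ^ 2 + (m₂ : ℝ)⁻¹) ≤ d / (3200 * n) := fun σ h0 h1 =>
    MIA.noise_le_signal hn hρ h0 h1 (by linarith) hdn
  have hψ := MIA.measurable_whitenedAttack (d := d) (m := m) (N + 1) m₂ (1 / 800 * (d : ℝ) / n)
  refine ⟨hsum, hψ, ?_⟩
  have hout : MeasurableSet {ω : MIA.E d × ((Fin n → MIA.E d) × MIA.E d) × (Fin m → MIA.E d) |
      MIA.whitenedAttack (N + 1) m₂ (1 / 800 * (d : ℝ) / n) ω.2.2 ω.2.1.2 ω.1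
        = MIA.Verdict.OUT} :=
    (hψ.comp (by fun_prop : Measurable fun ω : MIA.E d × ((Fin n → MIA.E d) × MIA.E d) ×
      (Fin m → MIA.E d) => (ω.2.2, ω.2.1.2, ω.1))) (t := {MIA.Verdict.OUT}) trivial
  have hin : MeasurableSet {ω : MIA.E d × ((Fin n → MIA.E d) × MIA.E d) × (Fin m → MIA.E d) |
      MIA.whitenedAttack (N + 1) m₂ (1 / 800 * (d : ℝ) / n) ω.2.2 ω.2.1.2 (ω.2.1.1 0)
        = MIA.Verdict.IN} :=
    (hψ.comp (by fun_prop : Measurable fun ω : MIA.E d × ((Fin n → MIA.E d) × MIA.E d) ×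
      (Fin m → MIA.E d) => (ω.2.2, ω.2.1.2, ω.2.1.1 0))) (t := {MIA.Verdict.IN}) trivial
  rintro A (hA | hA) D hD
  · obtain ⟨μ, S, hS, -, hDμ⟩ := MIA.exists_of_mem_gaussianFamily hD
    -- The estimate is the exact empirical mean up to probability `0.01`: noise level `σ = 0`.
    obtain ⟨h1, h2⟩ := H (n := n) hdd₀ hNd hm₂0 hsum 0 (hsig 0 le_rfl hρ.le) μ
      (MIA.transpose_sqrt S) (MIA.det_sqrt_ne_zero hS)
    simp only [zero_smul, add_zero] at h1 h2
    have h3 := MIA.le_measureReal_of_symmetricClass hA hD hDμ hout h1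
    have h4 := MIA.le_measureReal_of_symmetricClass hA hD hDμ hin h2
    exact ⟨le_trans (by norm_num) h3, le_trans (by norm_num) h4⟩
  · rw [Set.mem_singleton_iff] at hA
    subst hA
    obtain ⟨μ, S, hS, hcov, hDμ⟩ := MIA.exists_of_mem_gaussianFamily hD
    obtain ⟨h1, h2⟩ := H (n := n) hdd₀ hNd hm₂0 hsum ρ (hsig ρ hρ.le le_rfl) μ
      (MIA.transpose_sqrt S) (MIA.det_sqrt_ne_zero hS)
    have hmp := MIA.measurePreserving_gameLaw_noisyEmpMean (n := n) (m := m) (ρ := ρ) hDμ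
      (by rw [hcov]; rfl)
    rw [← hmp.measureReal_preimage hout.nullMeasurableSet,
      ← hmp.measureReal_preimage hin.nullMeasurableSet]
    have hest : ∀ (R : Matrix (Fin d) (Fin d) ℝ) (g : MIA.GameIndex n m → MIA.E d), MIA.empMean
        (fun i => MIA.affineMap μ R (MIA.train g i)) + ρ • MIA.affineMap 0 R (MIA.noise g)
        = MIA.affineMap μ R (MIA.empMean (MIA.train g) + ρ • MIA.noise g) := fun R g => by
      rw [MIA.empMean_affineMap]
      simp only [MIA.affineMap, zero_add, map_add, map_smul, add_assoc]
    simp only [Set.preimage, Set.mem_ofPred_eq, hest]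
    exact ⟨le_trans (by norm_num) h1, le_trans (by norm_num) h2⟩
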